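/- Let $k$ be a field and let $C$ be a (coassociative, counital) cocommutative coalgebra over $k$ with a coaugmentation, i.e. a homomorphism of coalgebras $\gamma\colon k\to C$. Put $C_+=C/\gamma(k)$, with its induced noncounital comultiplication $\mu\colon C_+\to C_+\otimes_k C_+$, and assume that $C$ is conilpotent: for every $d\in C_+$ there is an $n\ge 1$ such that the iterated comultiplication $\mu^{(n)}\colon C_+\to C_+^{\otimes (n+1)}$ annihilates $d$. Regard $k$ as a left $C$-comodule via $\gamma$, and let $\mathrm{Ext}^n_C$ denote the Yoneda Ext in the abelian category of left $C$-comodules. Assume that $C$ is finitely cogenerated, i.e. that the $k$-vector space $\mathrm{Ext}^1_C(k,k)$ is finite-dimensional. Then $C$ is co-Noetherian (on the left and on the right): every quotient comodule of a finitely cogenerated left (respectively, right) $C$-comodule is finitely cogenerated, where a left (respectively, right) $C$-comodule is called finitely cogenerated if it embeds as a subcomodule into a cofree comodule $C\otimes_k V$ (respectively, $V\otimes_k C$) with a finite-dimensional $k$-vector space $V$. Moreover, $C$ is weakly finitely Koszul: the $k$-vector space $\mathrm{Ext}^n_C(k,k)$ is finite-dimensional for every $n\ge 0$. -/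

import Mathlib

open CategoryTheory Limits TensorProduct

universe u

set_option linter.unusedSectionVars false

namespace CoalgComod

noncomputable section

/-! ### Conilpotent coalgebras -/

section Conilpotent

variable {k C : Type u} [Field k] [AddCommGroup C] [Module k C] [Coalgebra k C]

/-- For a coaugmentation `γ : k → C`, the vector space `C₊ = C / γ(k)`. -/
abbrev CPlus (γ : k →ₗc[k] C) : Type u := C ⧸ LinearMap.range γ.toLinearMap

theorem map_mkQ_comul_coaug (γ : k →ₗc[k] C) :
    LinearMap.range γ.toLinearMap ≤ LinearMap.ker
      (TensorProduct.map (LinearMap.range γ.toLinearMap).mkQ (LinearMap.range γ.toLinearMap).mkQ ∘ₗ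
        Coalgebra.comul (R := k) (A := C)) := by
  rintro _ ⟨a, rfl⟩
  have h : Coalgebra.comul (R := k) (γ.toLinearMap a) =
      TensorProduct.map γ.toLinearMap γ.toLinearMap (Coalgebra.comul (R := k) a) :=
    (LinearMap.congr_fun γ.map_comp_comul a).symm
  have h0 : (LinearMap.range γ.toLinearMap).mkQ (γ.toLinearMap a) = 0 :=
    (Submodule.Quotient.mk_eq_zero _).2 ⟨a, rfl⟩
  rw [LinearMap.mem_ker, LinearMap.comp_apply, h, CommSemiring.comul_apply,
    TensorProduct.map_tmul, TensorProduct.map_tmul, h0, TensorProduct.tmul_zero]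

/-- The comultiplication of the noncounital coalgebra `C₊ = C / γ(k)`: the unique map that makes
the projection `C → C₊` compatible with the comultiplications. -/
def comulPlus (γ : k →ₗc[k] C) : CPlus γ →ₗ[k] CPlus γ ⊗[k] CPlus γ :=
  (LinearMap.range γ.toLinearMap).liftQ
    (TensorProduct.map (LinearMap.range γ.toLinearMap).mkQ (LinearMap.range γ.toLinearMap).mkQ ∘ₗ
        Coalgebra.comul (R := k) (A := C))
    (map_mkQ_comul_coaug γ)

end Conilpotent

/-- The iterated comultiplication `μ⁽ⁿ⁾ : D → D^{⊗ (n+1)}` of a linear map `μ : D → D ⊗ D`: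
`μ⁽⁰⁾` is the identity and `μ⁽ⁿ⁺¹⁾ = (μ⁽ⁿ⁾ ⊗ id) ∘ μ`. -/
def iterComul {k D : Type u} [Field k] [AddCommGroup D] [Module k D] (μ : D →ₗ[k] D ⊗[k] D) :
    (n : ℕ) → D →ₗ[k] ⨂[k]^(n + 1) D
  | 0 => (PiTensorProduct.subsingletonEquiv (R := k) (s := fun _ : Fin 1 => D) 0).symm.toLinearMap
  | n + 1 =>
    (TensorPower.mulEquiv (R := k) (M := D) (n := n + 1) (m := 1)).toLinearMap ∘ₗ
      TensorProduct.map (iterComul μ n)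
        (PiTensorProduct.subsingletonEquiv (R := k) (s := fun _ : Fin 1 => D) 0).symm.toLinearMap ∘ₗ μ

/-- The coaugmented coalgebra `(C, γ)` is conilpotent: every element of `C₊` is annihilated by
some iterated comultiplication. -/
def IsConilpotent {k C : Type u} [Field k] [AddCommGroup C] [Module k C] [Coalgebra k C]
    (γ : k →ₗc[k] C) : Prop :=
  ∀ d : CPlus γ, ∃ n : ℕ, 1 ≤ n ∧ iterComul (comulPlus γ) n d = 0

/-! ### The opposite coalgebra -/

section Cop

/-- The underlying space of the opposite coalgebra. -/
def Cop (C : Type u) : Type u := C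

variable {k C : Type u} [Field k] [AddCommGroup C] [Module k C] [Coalgebra k C]

instance : AddCommGroup (Cop C) := inferInstanceAs (AddCommGroup C)

instance : Module k (Cop C) := inferInstanceAs (Module k C)

theorem cop_coassoc :
    (TensorProduct.assoc k C C C).toLinearMap ∘ₗ
      ((TensorProduct.comm k C C).toLinearMap ∘ₗ Coalgebra.comul (R := k) (A := C)).rTensor C ∘ₗ
        ((TensorProduct.comm k C C).toLinearMap ∘ₗ Coalgebra.comul (R := k) (A := C)) =
    ((TensorProduct.comm k C C).toLinearMap ∘ₗ Coalgebra.comul (R := k) (A := C)).lTensor C ∘ₗ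
        ((TensorProduct.comm k C C).toLinearMap ∘ₗ Coalgebra.comul (R := k) (A := C)) := by
  have e1 : (Coalgebra.comul (R := k) (A := C)).rTensor C ∘ₗ (TensorProduct.comm k C C).toLinearMap
      = (TensorProduct.comm k C (C ⊗[k] C)).toLinearMap ∘ₗ
        (Coalgebra.comul (R := k) (A := C)).lTensor C := by
    ext x y; simp
  have e2 : (Coalgebra.comul (R := k) (A := C)).lTensor C ∘ₗ (TensorProduct.comm k C C).toLinearMap
      = (TensorProduct.comm k (C ⊗[k] C) C).toLinearMap ∘ₗ
        (Coalgebra.comul (R := k) (A := C)).rTensor C := by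
    ext x y; simp
  have e3 : (TensorProduct.assoc k C C C).toLinearMap ∘ₗ
      ((TensorProduct.comm k C C).toLinearMap).rTensor C ∘ₗ
        (TensorProduct.comm k C (C ⊗[k] C)).toLinearMap ∘ₗ
          (TensorProduct.assoc k C C C).toLinearMap =
      ((TensorProduct.comm k C C).toLinearMap).lTensor C ∘ₗ
        (TensorProduct.comm k (C ⊗[k] C) C).toLinearMap := by
    ext x y z; simp
  have h := Coalgebra.coassoc (R := k) (A := C)
  ext c
  have h1 := LinearMap.congr_fun h c
  have e1c := LinearMap.congr_fun e1 (Coalgebra.comul (R := k) c)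
  have e2c := LinearMap.congr_fun e2 (Coalgebra.comul (R := k) c)
  have e3c := LinearMap.congr_fun e3
    ((Coalgebra.comul (R := k) (A := C)).rTensor C (Coalgebra.comul (R := k) c))
  simp only [LinearMap.comp_apply, LinearMap.rTensor_comp, LinearMap.lTensor_comp] at *
  rw [e1c, e2c, ← e3c, ← h1]

/-- The opposite coalgebra: same counit, comultiplication followed by the flip. -/
instance : Coalgebra k (Cop C) where
  comul := (TensorProduct.comm k C C).toLinearMap ∘ₗ Coalgebra.comul (R := k) (A := C)
  counit := Coalgebra.counit (R := k) (A := C)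
  coassoc := cop_coassoc (k := k) (C := C)
  rTensor_counit_comp_comul := by
    have e : (Coalgebra.counit (R := k) (A := C)).rTensor C ∘ₗ (TensorProduct.comm k C C).toLinearMap
        = (TensorProduct.comm k C k).toLinearMap ∘ₗ
          (Coalgebra.counit (R := k) (A := C)).lTensor C := by
      ext x y; simp
    change (Coalgebra.counit (R := k) (A := C)).rTensor C ∘ₗ
      ((TensorProduct.comm k C C).toLinearMap ∘ₗ Coalgebra.comul (R := k) (A := C)) =
        TensorProduct.mk k k C 1
    rw [← LinearMap.comp_assoc, e, LinearMap.comp_assoc, Coalgebra.lTensor_counit_comp_comul]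
    ext x; simp
  lTensor_counit_comp_comul := by
    have e : (Coalgebra.counit (R := k) (A := C)).lTensor C ∘ₗ (TensorProduct.comm k C C).toLinearMap
        = (TensorProduct.comm k k C).toLinearMap ∘ₗ
          (Coalgebra.counit (R := k) (A := C)).rTensor C := by
      ext x y; simp
    change (Coalgebra.counit (R := k) (A := C)).lTensor C ∘ₗ
      ((TensorProduct.comm k C C).toLinearMap ∘ₗ Coalgebra.comul (R := k) (A := C)) =
        (TensorProduct.mk k C k).flip 1
    rw [← LinearMap.comp_assoc, e, LinearMap.comp_assoc, Coalgebra.rTensor_counit_comp_comul]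
    ext x; simp

end Cop

/-! ### The category of left comodules -/

/-- A left comodule over the coalgebra `C`. -/
structure Comod (k C : Type u) [Field k] [AddCommGroup C] [Module k C] [Coalgebra k C] where
  /-- the underlying vector space -/
  carrier : Type u
  [addCommGroup : AddCommGroup carrier]
  [module : Module k carrier]
  /-- the coaction map -/
  coact : carrier →ₗ[k] C ⊗[k] carrier
  coassoc : (TensorProduct.assoc k C C carrier).toLinearMap ∘ₗ
      (Coalgebra.comul (R := k) (A := C)).rTensor carrier ∘ₗ coact = coact.lTensor C ∘ₗ coact
  counit : (TensorProduct.lid k carrier).toLinearMap ∘ₗ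
      (Coalgebra.counit (R := k) (A := C)).rTensor carrier ∘ₗ coact = LinearMap.id

namespace Comod

attribute [instance] Comod.addCommGroup Comod.module

variable {k C : Type u} [Field k] [AddCommGroup C] [Module k C] [Coalgebra k C]

instance : CoeSort (Comod k C) (Type u) := ⟨Comod.carrier⟩

/-- Morphisms of left comodules: linear maps compatible with the coactions. -/
@[ext]
structure Hom (M N : Comod k C) where
  /-- the underlying linear map -/
  lin : M →ₗ[k] N
  comm : N.coact ∘ₗ lin = lin.lTensor C ∘ₗ M.coact

instance : Category.{u} (Comod k C) where
  Hom M N := Hom M N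
  id M := ⟨LinearMap.id, by simp⟩
  comp f g := ⟨g.lin ∘ₗ f.lin, by
    rw [← LinearMap.comp_assoc, g.comm, LinearMap.comp_assoc, f.comm, ← LinearMap.comp_assoc,
      LinearMap.lTensor_comp]⟩

@[ext]
theorem hom_ext {M N : Comod k C} {f g : M ⟶ N} (h : Hom.lin f = Hom.lin g) : f = g := Hom.ext h

@[simp] theorem id_lin (M : Comod k C) : Hom.lin (𝟙 M) = LinearMap.id := rfl

@[simp] theorem comp_lin {M N P : Comod k C} (f : M ⟶ N) (g : N ⟶ P) :
    Hom.lin (f ≫ g) = Hom.lin g ∘ₗ Hom.lin f := rfl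

section Linear

variable {M N : Comod k C}

instance : Zero (M ⟶ N) := ⟨⟨0, by simp⟩⟩

instance : Add (M ⟶ N) := ⟨fun f g => ⟨Hom.lin f + Hom.lin g, by
  rw [LinearMap.comp_add, Hom.comm f, Hom.comm g, LinearMap.lTensor_add, LinearMap.add_comp]⟩⟩

instance : Neg (M ⟶ N) := ⟨fun f => ⟨- Hom.lin f, by
  rw [LinearMap.comp_neg, Hom.comm f, LinearMap.lTensor_neg, LinearMap.neg_comp]⟩⟩

instance : Sub (M ⟶ N) := ⟨fun f g => ⟨Hom.lin f - Hom.lin g, by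
  rw [LinearMap.comp_sub, Hom.comm f, Hom.comm g, LinearMap.lTensor_sub, LinearMap.sub_comp]⟩⟩

instance : SMul k (M ⟶ N) := ⟨fun a f => ⟨a • Hom.lin f, by
  rw [LinearMap.comp_smul, Hom.comm f, LinearMap.lTensor_smul, LinearMap.smul_comp]⟩⟩

instance : SMul ℕ (M ⟶ N) := ⟨fun n f => ⟨n • Hom.lin f, by
  rw [← Nat.cast_smul_eq_nsmul k n (Hom.lin f), LinearMap.comp_smul, Hom.comm f,
    LinearMap.lTensor_smul, LinearMap.smul_comp]⟩⟩

instance : SMul ℤ (M ⟶ N) := ⟨fun n f => ⟨n • Hom.lin f, by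
  rw [← Int.cast_smul_eq_zsmul k n (Hom.lin f), LinearMap.comp_smul, Hom.comm f,
    LinearMap.lTensor_smul, LinearMap.smul_comp]⟩⟩

theorem lin_injective : Function.Injective (fun f : M ⟶ N => Hom.lin f) := fun _ _ h => hom_ext h

instance : AddCommGroup (M ⟶ N) :=
  lin_injective.addCommGroup _ rfl (fun _ _ => rfl) (fun _ => rfl) (fun _ _ => rfl)
    (fun _ _ => rfl) (fun _ _ => rfl)

@[simp] theorem zero_lin : Hom.lin (0 : M ⟶ N) = 0 := rfl

@[simp] theorem add_lin (f g : M ⟶ N) : Hom.lin (f + g) = Hom.lin f + Hom.lin g := rfl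

@[simp] theorem smul_lin (a : k) (f : M ⟶ N) : Hom.lin (a • f) = a • Hom.lin f := rfl

/-- Taking the underlying linear map, as an additive map. -/
def linAddHom : (M ⟶ N) →+ (M →ₗ[k] N) where
  toFun f := Hom.lin f
  map_zero' := rfl
  map_add' _ _ := rfl

instance : Module k (M ⟶ N) :=
  Function.Injective.module k linAddHom lin_injective (fun _ _ => rfl)

instance : Preadditive (Comod k C) where
  homGroup _ _ := inferInstance
  add_comp _ _ _ _ _ _ := hom_ext (LinearMap.comp_add _ _ _)
  comp_add _ _ _ _ _ _ := hom_ext (LinearMap.add_comp _ _ _)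

instance : Linear k (Comod k C) where
  homModule _ _ := inferInstance
  smul_comp _ _ _ _ _ _ := hom_ext (LinearMap.comp_smul _ _ _)
  comp_smul _ _ _ _ _ _ := hom_ext (LinearMap.smul_comp _ _ _)

end Linear

/-! Compatibility of the two sides of the comodule axioms with linear maps. -/

section Axioms

variable {M N : Type u} [AddCommGroup M] [Module k M] [AddCommGroup N] [Module k N]
  {ρ : M →ₗ[k] C ⊗[k] M} {σ : N →ₗ[k] C ⊗[k] N} {f : M →ₗ[k] N}

theorem coassoc_left_natural (h : σ ∘ₗ f = f.lTensor C ∘ₗ ρ) :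
    ((TensorProduct.assoc k C C N).toLinearMap ∘ₗ
      (Coalgebra.comul (R := k) (A := C)).rTensor N ∘ₗ σ) ∘ₗ f =
    (f.lTensor C).lTensor C ∘ₗ ((TensorProduct.assoc k C C M).toLinearMap ∘ₗ
      (Coalgebra.comul (R := k) (A := C)).rTensor M ∘ₗ ρ) := by
  have e1 : (Coalgebra.comul (R := k) (A := C)).rTensor N ∘ₗ f.lTensor C =
      f.lTensor (C ⊗[k] C) ∘ₗ (Coalgebra.comul (R := k) (A := C)).rTensor M := by
    rw [LinearMap.rTensor_comp_lTensor, LinearMap.lTensor_comp_rTensor]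
  have e2 : (TensorProduct.assoc k C C N).toLinearMap ∘ₗ f.lTensor (C ⊗[k] C) =
      (f.lTensor C).lTensor C ∘ₗ (TensorProduct.assoc k C C M).toLinearMap := by
    ext x y z; simp
  rw [LinearMap.comp_assoc, LinearMap.comp_assoc, h, ← LinearMap.comp_assoc ρ, e1,
    LinearMap.comp_assoc, ← LinearMap.comp_assoc _ _ (TensorProduct.assoc k C C N).toLinearMap, e2,
    LinearMap.comp_assoc]

theorem coassoc_right_natural (h : σ ∘ₗ f = f.lTensor C ∘ₗ ρ) :
    (σ.lTensor C ∘ₗ σ) ∘ₗ f = (f.lTensor C).lTensor C ∘ₗ (ρ.lTensor C ∘ₗ ρ) := by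
  rw [LinearMap.comp_assoc, h, ← LinearMap.comp_assoc, ← LinearMap.lTensor_comp, h,
    LinearMap.lTensor_comp, LinearMap.comp_assoc]

theorem counit_natural (h : σ ∘ₗ f = f.lTensor C ∘ₗ ρ) :
    ((TensorProduct.lid k N).toLinearMap ∘ₗ
      (Coalgebra.counit (R := k) (A := C)).rTensor N ∘ₗ σ) ∘ₗ f =
    f ∘ₗ ((TensorProduct.lid k M).toLinearMap ∘ₗ
      (Coalgebra.counit (R := k) (A := C)).rTensor M ∘ₗ ρ) := by
  have e1 : (Coalgebra.counit (R := k) (A := C)).rTensor N ∘ₗ f.lTensor C =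
      f.lTensor k ∘ₗ (Coalgebra.counit (R := k) (A := C)).rTensor M := by
    rw [LinearMap.rTensor_comp_lTensor, LinearMap.lTensor_comp_rTensor]
  have e2 : (TensorProduct.lid k N).toLinearMap ∘ₗ f.lTensor k =
      f ∘ₗ (TensorProduct.lid k M).toLinearMap := by
    ext x; simp
  rw [LinearMap.comp_assoc, LinearMap.comp_assoc, h, ← LinearMap.comp_assoc ρ, e1,
    LinearMap.comp_assoc, ← LinearMap.comp_assoc _ _ (TensorProduct.lid k N).toLinearMap, e2,
    LinearMap.comp_assoc]

end Axioms

theorem lTensor_injective {M N : Type u} [AddCommGroup M] [Module k M] [AddCommGroup N]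
    [Module k N] {f : M →ₗ[k] N} (hf : Function.Injective f) :
    Function.Injective (f.lTensor C) :=
  Module.Flat.lTensor_preserves_injective_linearMap f hf

/-! Subcomodules and quotient comodules. -/

section Sub

variable (M : Comod k C) (S : Submodule k M)
  (hS : ∀ m ∈ S, M.coact m ∈ LinearMap.range (S.subtype.lTensor C))

/-- The coaction on a subcomodule. -/
def subCoact : S →ₗ[k] C ⊗[k] S :=
  (LinearEquiv.ofInjective (S.subtype.lTensor C)
    (lTensor_injective S.injective_subtype)).symm.toLinearMap ∘ₗ
    (M.coact ∘ₗ S.subtype).codRestrict _ (fun m => hS m m.2)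

theorem subCoact_comm : M.coact ∘ₗ S.subtype = S.subtype.lTensor C ∘ₗ subCoact M S hS := by
  ext m
  have := LinearEquiv.apply_symm_apply (LinearEquiv.ofInjective (S.subtype.lTensor C)
    (lTensor_injective S.injective_subtype)) ((M.coact ∘ₗ S.subtype).codRestrict _
      (fun m => hS m m.2) m)
  exact (congrArg Subtype.val this).symm

/-- A subcomodule, as a comodule. -/
def sub : Comod k C where
  carrier := S
  coact := subCoact M S hS
  coassoc := by
    have h := subCoact_comm M S hS
    have h2 := (coassoc_left_natural h).symm.trans
      ((congrArg (· ∘ₗ S.subtype) M.coassoc).trans (coassoc_right_natural h))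
    ext m
    exact lTensor_injective (lTensor_injective S.injective_subtype) (LinearMap.congr_fun h2 m)
  counit := by
    have h := counit_natural (subCoact_comm M S hS)
    rw [M.counit] at h
    apply LinearMap.ext
    intro m
    exact S.injective_subtype (LinearMap.congr_fun h m).symm

/-- The inclusion of a subcomodule. -/
def subι : sub M S hS ⟶ M := ⟨S.subtype, subCoact_comm M S hS⟩

end Sub

section Quot

variable (M : Comod k C) (S : Submodule k M)
  (hS : S ≤ LinearMap.ker (S.mkQ.lTensor C ∘ₗ M.coact))

theorem quotCoact_comm :
    S.liftQ (S.mkQ.lTensor C ∘ₗ M.coact) hS ∘ₗ S.mkQ = S.mkQ.lTensor C ∘ₗ M.coact :=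
  S.liftQ_mkQ _ _

/-- The quotient of a comodule by a subcomodule. -/
def quot : Comod k C where
  carrier := M ⧸ S
  coact := S.liftQ (S.mkQ.lTensor C ∘ₗ M.coact) hS
  coassoc := by
    have h := quotCoact_comm M S hS
    rw [← LinearMap.cancel_right S.mkQ_surjective, coassoc_left_natural h,
      coassoc_right_natural h, M.coassoc]
  counit := by
    have h := quotCoact_comm M S hS
    rw [← LinearMap.cancel_right S.mkQ_surjective, counit_natural h, M.counit]
    rfl

/-- The projection onto a quotient comodule. -/
def quotπ : M ⟶ quot M S hS := ⟨S.mkQ, quotCoact_comm M S hS⟩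

end Quot

/-! Factoring morphisms through injective or surjective ones. -/

/-- A morphism `g` whose image lies in the image of an injective morphism `f` factors
through `f`. -/
def lift {K M W : Comod k C} (f : K ⟶ M) (hf : Function.Injective (Hom.lin f)) (g : W ⟶ M)
    (hg : LinearMap.range (Hom.lin g) ≤ LinearMap.range (Hom.lin f)) : W ⟶ K :=
  have h0 : Hom.lin f ∘ₗ ((LinearEquiv.ofInjective (Hom.lin f) hf).symm.toLinearMap ∘ₗ
      (Hom.lin g).codRestrict _ (fun w => hg ⟨w, rfl⟩)) = Hom.lin g := by
    ext w
    exact congrArg Subtype.val (LinearEquiv.apply_symm_apply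
      (LinearEquiv.ofInjective (Hom.lin f) hf) ((Hom.lin g).codRestrict _ (fun w => hg ⟨w, rfl⟩) w))
  ⟨(LinearEquiv.ofInjective (Hom.lin f) hf).symm.toLinearMap ∘ₗ
      (Hom.lin g).codRestrict _ (fun w => hg ⟨w, rfl⟩), by
    rw [← LinearMap.cancel_left (lTensor_injective (C := C) hf), ← LinearMap.comp_assoc,
      ← Hom.comm f, LinearMap.comp_assoc, h0, Hom.comm g, ← LinearMap.comp_assoc,
      ← LinearMap.lTensor_comp, h0]⟩

theorem lift_comp {K M W : Comod k C} (f : K ⟶ M) (hf : Function.Injective (Hom.lin f))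
    (g : W ⟶ M) (hg : LinearMap.range (Hom.lin g) ≤ LinearMap.range (Hom.lin f)) :
    lift f hf g hg ≫ f = g := by
  apply hom_ext
  ext w
  exact congrArg Subtype.val (LinearEquiv.apply_symm_apply
    (LinearEquiv.ofInjective (Hom.lin f) hf) ((Hom.lin g).codRestrict _ (fun w => hg ⟨w, rfl⟩) w))

/-- A morphism `g` whose kernel contains the kernel of a surjective morphism `f` factors
through `f`. -/
def desc {M N W : Comod k C} (f : M ⟶ N) (hf : Function.Surjective (Hom.lin f)) (g : M ⟶ W)
    (hg : LinearMap.ker (Hom.lin f) ≤ LinearMap.ker (Hom.lin g)) : N ⟶ W :=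
  have h0 : ((LinearMap.ker (Hom.lin f)).liftQ (Hom.lin g) hg ∘ₗ
      ((Hom.lin f).quotKerEquivOfSurjective hf).symm.toLinearMap) ∘ₗ Hom.lin f = Hom.lin g := by
    ext m
    have : ((Hom.lin f).quotKerEquivOfSurjective hf).symm (Hom.lin f m) =
        Submodule.Quotient.mk m := by
      rw [LinearEquiv.symm_apply_eq]; rfl
    simp [this]
  ⟨(LinearMap.ker (Hom.lin f)).liftQ (Hom.lin g) hg ∘ₗ
      ((Hom.lin f).quotKerEquivOfSurjective hf).symm.toLinearMap, by
    rw [← LinearMap.cancel_right hf, LinearMap.comp_assoc, h0, Hom.comm g, LinearMap.comp_assoc,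
      Hom.comm f, ← LinearMap.comp_assoc, ← LinearMap.lTensor_comp, h0]⟩

theorem comp_desc {M N W : Comod k C} (f : M ⟶ N) (hf : Function.Surjective (Hom.lin f))
    (g : M ⟶ W) (hg : LinearMap.ker (Hom.lin f) ≤ LinearMap.ker (Hom.lin g)) :
    f ≫ desc f hf g hg = g := by
  apply hom_ext
  ext m
  have : ((Hom.lin f).quotKerEquivOfSurjective hf).symm (Hom.lin f m) =
      Submodule.Quotient.mk m := by
    rw [LinearEquiv.symm_apply_eq]; rfl
  simp [desc, this]

/-! Kernels, cokernels and finite products. -/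

section Ker

variable {M N : Comod k C} (f : M ⟶ N)

theorem ker_stable : ∀ m ∈ LinearMap.ker (Hom.lin f),
    M.coact m ∈ LinearMap.range ((LinearMap.ker (Hom.lin f)).subtype.lTensor C) := by
  intro m hm
  have hex := Module.Flat.lTensor_exact (R := k) C
    (LinearMap.exact_subtype_ker_map (Hom.lin f))
  refine (hex _).1 ?_
  have := LinearMap.congr_fun (Hom.comm f) m
  simp only [LinearMap.comp_apply] at this
  rw [← this, LinearMap.mem_ker.1 hm, map_zero]

/-- The kernel of a morphism of comodules. -/
def ker : Comod k C := sub M (LinearMap.ker (Hom.lin f)) (ker_stable f)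

/-- The inclusion of the kernel. -/
def kerι : ker f ⟶ M := subι M (LinearMap.ker (Hom.lin f)) (ker_stable f)

theorem kerι_injective : Function.Injective (Hom.lin (kerι f)) :=
  (LinearMap.ker (Hom.lin f)).injective_subtype

theorem range_kerι : LinearMap.range (Hom.lin (kerι f)) = LinearMap.ker (Hom.lin f) :=
  Submodule.range_subtype _

theorem kerι_comp : kerι f ≫ f = 0 := by
  apply hom_ext
  ext m
  exact m.2

theorem range_le_ker {A : Comod k C} {g : A ⟶ M} (h : g ≫ f = 0) :
    LinearMap.range (Hom.lin g) ≤ LinearMap.ker (Hom.lin f) := by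
  rw [LinearMap.range_le_ker_iff]
  exact congrArg (fun t => Hom.lin t) h

theorem mono_of_injective (hf : Function.Injective (Hom.lin f)) : Mono f :=
  ⟨fun _ _ w => hom_ext ((LinearMap.cancel_left hf).1 (congrArg (fun t => Hom.lin t) w))⟩

theorem epi_of_surjective (hf : Function.Surjective (Hom.lin f)) : Epi f :=
  ⟨fun _ _ w => hom_ext ((LinearMap.cancel_right hf).1 (congrArg (fun t => Hom.lin t) w))⟩

/-- An injective morphism is a kernel of any morphism with which it forms an exact pair. -/
def isLimitOfExact {A : Comod k C} (g : A ⟶ M) (hg : Function.Injective (Hom.lin g))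
    (w : g ≫ f = 0) (h : LinearMap.ker (Hom.lin f) ≤ LinearMap.range (Hom.lin g)) :
    IsLimit (KernelFork.ofι g w) :=
  haveI := mono_of_injective g hg
  KernelFork.IsLimit.ofι g w (fun s hs => lift g hg s ((range_le_ker f hs).trans h))
    (fun s hs => lift_comp _ _ _ _)
    (fun s hs m hm => by rw [← cancel_mono g, hm, lift_comp])

/-- A surjective morphism is a cokernel of any morphism with which it forms an exact pair. -/
def isColimitOfExact {B : Comod k C} (g : N ⟶ B) (hg : Function.Surjective (Hom.lin g))
    (w : f ≫ g = 0) (h : LinearMap.ker (Hom.lin g) ≤ LinearMap.range (Hom.lin f)) :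
    IsColimit (CokernelCofork.ofπ g w) :=
  haveI := epi_of_surjective g hg
  CokernelCofork.IsColimit.ofπ g w
    (fun s hs => desc g hg s (h.trans (range_le_ker s hs)))
    (fun s hs => comp_desc _ _ _ _)
    (fun s hs m hm => by rw [← cancel_epi g, hm, comp_desc])

theorem range_stable : LinearMap.range (Hom.lin f) ≤
    LinearMap.ker ((LinearMap.range (Hom.lin f)).mkQ.lTensor C ∘ₗ N.coact) := by
  rw [LinearMap.range_le_ker_iff, LinearMap.comp_assoc, Hom.comm f, ← LinearMap.comp_assoc,
    ← LinearMap.lTensor_comp, LinearMap.range_mkQ_comp, LinearMap.lTensor_zero,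
    LinearMap.zero_comp]

/-- The cokernel of a morphism of comodules. -/
def coker : Comod k C := quot N (LinearMap.range (Hom.lin f)) (range_stable f)

/-- The projection onto the cokernel. -/
def cokerπ : N ⟶ coker f := quotπ N (LinearMap.range (Hom.lin f)) (range_stable f)

theorem cokerπ_surjective : Function.Surjective (Hom.lin (cokerπ f)) :=
  (LinearMap.range (Hom.lin f)).mkQ_surjective

theorem ker_cokerπ : LinearMap.ker (Hom.lin (cokerπ f)) = LinearMap.range (Hom.lin f) :=
  Submodule.ker_mkQ _

theorem comp_cokerπ : f ≫ cokerπ f = 0 := hom_ext (LinearMap.range_mkQ_comp _)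

theorem injective_of_mono [Mono f] : Function.Injective (Hom.lin f) := by
  have h : kerι f = 0 := by rw [← cancel_mono f, kerι_comp, zero_comp]
  have h2 := range_kerι f
  rw [h, zero_lin, LinearMap.range_zero] at h2
  exact LinearMap.ker_eq_bot.1 h2.symm

theorem surjective_of_epi [Epi f] : Function.Surjective (Hom.lin f) := by
  have h : cokerπ f = 0 := by rw [← cancel_epi f, comp_cokerπ, comp_zero]
  have h2 := ker_cokerπ f
  rw [h, zero_lin, LinearMap.ker_zero] at h2
  exact LinearMap.range_eq_top.1 h2.symm

end Ker

instance : HasKernels (Comod k C) where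
  has_limit f := ⟨_, isLimitOfExact f (kerι f) (kerι_injective f) (kerι_comp f)
    (range_kerι f).ge⟩

instance : HasCokernels (Comod k C) where
  has_colimit f := ⟨_, isColimitOfExact f (cokerπ f) (cokerπ_surjective f) (comp_cokerπ f)
    (ker_cokerπ f).le⟩

section Prod

variable (M N : Comod k C)

/-- The coaction on the direct sum of two comodules. -/
def prodCoact : (M × N) →ₗ[k] C ⊗[k] (M × N) :=
  ((LinearMap.inl k M N).lTensor C ∘ₗ M.coact).coprod ((LinearMap.inr k M N).lTensor C ∘ₗ N.coact)

theorem prodCoact_inl :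
    prodCoact M N ∘ₗ LinearMap.inl k M N = (LinearMap.inl k M N).lTensor C ∘ₗ M.coact :=
  LinearMap.coprod_inl _ _

theorem prodCoact_inr :
    prodCoact M N ∘ₗ LinearMap.inr k M N = (LinearMap.inr k M N).lTensor C ∘ₗ N.coact :=
  LinearMap.coprod_inr _ _

/-- The direct sum of two comodules. -/
def prod : Comod k C where
  carrier := M × N
  coact := prodCoact M N
  coassoc := by
    apply LinearMap.prod_ext
    · rw [coassoc_left_natural (prodCoact_inl M N), coassoc_right_natural (prodCoact_inl M N),
        M.coassoc]
    · rw [coassoc_left_natural (prodCoact_inr M N), coassoc_right_natural (prodCoact_inr M N),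
        N.coassoc]
  counit := by
    apply LinearMap.prod_ext
    · rw [counit_natural (prodCoact_inl M N), M.counit]; rfl
    · rw [counit_natural (prodCoact_inr M N), N.counit]; rfl

/-- The zero comodule. -/
def zero : Comod k C where
  carrier := PUnit
  coact := 0
  coassoc := by simp
  counit := LinearMap.ext fun _ => rfl

/-- The direct sum of two comodules is their biproduct. -/
def prodBicone : BinaryBicone M N where
  pt := prod M N
  fst := ⟨LinearMap.fst k M N, by
    apply LinearMap.prod_ext
    · change M.coact ∘ₗ LinearMap.fst k M N ∘ₗ LinearMap.inl k M N =
        (LinearMap.fst k M N).lTensor C ∘ₗ prodCoact M N ∘ₗ LinearMap.inl k M N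
      rw [prodCoact_inl, ← LinearMap.comp_assoc (M.coact), ← LinearMap.lTensor_comp, LinearMap.fst_comp_inl,
        LinearMap.lTensor_id]
      rfl
    · change M.coact ∘ₗ LinearMap.fst k M N ∘ₗ LinearMap.inr k M N =
        (LinearMap.fst k M N).lTensor C ∘ₗ prodCoact M N ∘ₗ LinearMap.inr k M N
      rw [prodCoact_inr, ← LinearMap.comp_assoc (N.coact), ← LinearMap.lTensor_comp, LinearMap.fst_comp_inr,
        LinearMap.lTensor_zero, LinearMap.comp_zero, LinearMap.zero_comp]⟩
  snd := ⟨LinearMap.snd k M N, by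
    apply LinearMap.prod_ext
    · change N.coact ∘ₗ LinearMap.snd k M N ∘ₗ LinearMap.inl k M N =
        (LinearMap.snd k M N).lTensor C ∘ₗ prodCoact M N ∘ₗ LinearMap.inl k M N
      rw [prodCoact_inl, ← LinearMap.comp_assoc (M.coact), ← LinearMap.lTensor_comp, LinearMap.snd_comp_inl,
        LinearMap.lTensor_zero, LinearMap.comp_zero, LinearMap.zero_comp]
    · change N.coact ∘ₗ LinearMap.snd k M N ∘ₗ LinearMap.inr k M N =
        (LinearMap.snd k M N).lTensor C ∘ₗ prodCoact M N ∘ₗ LinearMap.inr k M N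
      rw [prodCoact_inr, ← LinearMap.comp_assoc (N.coact), ← LinearMap.lTensor_comp, LinearMap.snd_comp_inr,
        LinearMap.lTensor_id]
      rfl⟩
  inl := ⟨LinearMap.inl k M N, prodCoact_inl M N⟩
  inr := ⟨LinearMap.inr k M N, prodCoact_inr M N⟩
  inl_fst := hom_ext (LinearMap.fst_comp_inl k M N)
  inl_snd := hom_ext (LinearMap.snd_comp_inl k M N)
  inr_fst := hom_ext (LinearMap.fst_comp_inr k M N)
  inr_snd := hom_ext (LinearMap.snd_comp_inr k M N)

end Prod

instance : HasBinaryBiproducts (Comod k C) where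
  has_binary_biproduct M N :=
    HasBinaryBiproduct.mk ⟨prodBicone M N, isBinaryBilimitOfTotal _ (by
      apply hom_ext
      apply LinearMap.ext
      rintro ⟨m, n⟩
      change (m, (0 : N)) + ((0 : M), n) = (m, n)
      simp)⟩

instance : HasZeroObject (Comod k C) :=
  ⟨zero, (IsZero.iff_id_eq_zero _).2 (hom_ext (LinearMap.ext fun _ => rfl))⟩

instance : HasFiniteProducts (Comod k C) :=
  haveI : HasTerminal (Comod k C) := HasZeroObject.hasTerminal
  hasFiniteProducts_of_has_binary_and_terminal

/-- The category of left comodules over a coalgebra over a field is abelian. -/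
instance : Abelian (Comod k C) where
  normalMonoOfMono f _ := ⟨⟨_, cokerπ f, comp_cokerπ f,
    isLimitOfExact _ f (injective_of_mono f) _ (ker_cokerπ f).le⟩⟩
  normalEpiOfEpi f _ := ⟨⟨_, kerι f, kerι_comp f,
    isColimitOfExact _ f (surjective_of_epi f) _ (range_kerι f).ge⟩⟩

instance : HasExt.{u + 1} (Comod k C) := HasExt.standard _

end Comod

/-! ### Cofree comodules, co-Noetherian coalgebras, weak finite Koszulity -/

section Main

variable (k C : Type u) [Field k] [AddCommGroup C] [Module k C] [Coalgebra k C]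

/-- The cofree left comodule `C ⊗ V`. -/
def cofree (V : Type u) [AddCommGroup V] [Module k V] : Comod k C where
  carrier := C ⊗[k] V
  coact := (TensorProduct.assoc k C C V).toLinearMap ∘ₗ
    (Coalgebra.comul (R := k) (A := C)).rTensor V
  coassoc := by
    have e1 : (Coalgebra.comul (R := k) (A := C)).rTensor (C ⊗[k] V) ∘ₗ
          (TensorProduct.assoc k C C V).toLinearMap =
        (TensorProduct.assoc k (C ⊗[k] C) C V).toLinearMap ∘ₗ
          ((Coalgebra.comul (R := k) (A := C)).rTensor C).rTensor V := by
      ext x y v; simp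
    have e2 : (TensorProduct.assoc k C C (C ⊗[k] V)).toLinearMap ∘ₗ
          (TensorProduct.assoc k (C ⊗[k] C) C V).toLinearMap =
        (TensorProduct.assoc k C C V).toLinearMap.lTensor C ∘ₗ
          (TensorProduct.assoc k C (C ⊗[k] C) V).toLinearMap ∘ₗ
            (TensorProduct.assoc k C C C).toLinearMap.rTensor V := by
      ext x y z v; simp
    have e3 : ((Coalgebra.comul (R := k) (A := C)).rTensor V).lTensor C ∘ₗ
          (TensorProduct.assoc k C C V).toLinearMap =
        (TensorProduct.assoc k C (C ⊗[k] C) V).toLinearMap ∘ₗ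
          ((Coalgebra.comul (R := k) (A := C)).lTensor C).rTensor V := by
      ext x y v; simp
    have h := congrArg (LinearMap.rTensor V) (Coalgebra.coassoc (R := k) (A := C))
    apply LinearMap.ext
    intro t
    have h1 := LinearMap.congr_fun h t
    have e1t := LinearMap.congr_fun e1 ((Coalgebra.comul (R := k) (A := C)).rTensor V t)
    have e2t := LinearMap.congr_fun e2 (((Coalgebra.comul (R := k) (A := C)).rTensor C).rTensor V
      ((Coalgebra.comul (R := k) (A := C)).rTensor V t))
    have e3t := LinearMap.congr_fun e3 ((Coalgebra.comul (R := k) (A := C)).rTensor V t)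
    simp only [LinearMap.comp_apply, LinearMap.rTensor_comp, LinearMap.lTensor_comp] at *
    rw [e1t, e2t, e3t, h1]
  counit := by
    have e : (TensorProduct.lid k (C ⊗[k] V)).toLinearMap ∘ₗ
          (Coalgebra.counit (R := k) (A := C)).rTensor (C ⊗[k] V) ∘ₗ
            (TensorProduct.assoc k C C V).toLinearMap =
        ((TensorProduct.lid k C).toLinearMap ∘ₗ
          (Coalgebra.counit (R := k) (A := C)).rTensor C).rTensor V := by
      ext x y v; simp [TensorProduct.smul_tmul']
    have h : ((TensorProduct.lid k C).toLinearMap ∘ₗ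
        (Coalgebra.counit (R := k) (A := C)).rTensor C) ∘ₗ Coalgebra.comul (R := k) (A := C) =
          LinearMap.id := by
      rw [LinearMap.comp_assoc, Coalgebra.rTensor_counit_comp_comul]
      ext x; simp
    rw [← LinearMap.comp_assoc _ _ (LinearMap.rTensor _ _), ← LinearMap.comp_assoc, e,
      ← LinearMap.rTensor_comp, h, LinearMap.rTensor_id]

variable {k C}

/-- The left comodule `k` defined by the coaugmentation `γ`, with coaction `a ↦ γ(1) ⊗ a`. -/
def triv (γ : k →ₗc[k] C) : Comod k C where
  carrier := k
  coact := γ.toLinearMap.rTensor k ∘ₗ (TensorProduct.lid k k).symm.toLinearMap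
  coassoc := by
    have h : Coalgebra.comul (R := k) (γ.toLinearMap 1) =
        γ.toLinearMap 1 ⊗ₜ[k] γ.toLinearMap 1 := by
      exact (LinearMap.congr_fun γ.map_comp_comul (1 : k)).symm
    apply LinearMap.ext_ring
    simp [h, -CoalgHom.coe_toLinearMap, -CoalgHom.toLinearMap_eq_coe]
  counit := by
    have h : Coalgebra.counit (R := k) (γ.toLinearMap 1) = (1 : k) :=
      LinearMap.congr_fun γ.counit_comp (1 : k)
    apply LinearMap.ext_ring
    simp [h, -CoalgHom.coe_toLinearMap, -CoalgHom.toLinearMap_eq_coe]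

/-- A left comodule is finitely cogenerated if it embeds into a cofree comodule `C ⊗ V` with
a finite-dimensional vector space `V`. -/
def IsFinCogenComod (L : Comod k C) : Prop :=
  ∃ (V : Type u) (_ : AddCommGroup V) (_ : Module k V) (_ : FiniteDimensional k V)
    (f : L ⟶ cofree k C V), Function.Injective (Comod.Hom.lin f)

variable (k C) in
/-- A coalgebra is left co-Noetherian if every quotient comodule of a finitely cogenerated left
comodule is finitely cogenerated. -/
def IsLeftCoNoetherian : Prop :=
  ∀ (L Q : Comod k C) (p : L ⟶ Q), Function.Surjective (Comod.Hom.lin p) →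
    IsFinCogenComod L → IsFinCogenComod Q

variable (k C) in
/-- A coalgebra is right co-Noetherian if its opposite coalgebra is left co-Noetherian; right
comodules are the left comodules over the opposite coalgebra. -/
def IsRightCoNoetherian : Prop := IsLeftCoNoetherian k (Cop C)

/-- The space `Extⁿ_C(k, k)` in the abelian category of left comodules. -/
abbrev ExtTriv (γ : k →ₗc[k] C) (n : ℕ) : Type (u + 1) :=
  Abelian.Ext (triv γ) (triv γ) n

/-- A conilpotent coalgebra is finitely cogenerated if its space of cogenerators `Ext¹_C(k, k)`
is finite-dimensional. -/
def IsFinCogenCoalgebra (γ : k →ₗc[k] C) : Prop := FiniteDimensional k (ExtTriv γ 1)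

/-- A conilpotent coalgebra is weakly finitely Koszul if all the spaces `Extⁿ_C(k, k)` are
finite-dimensional. -/
def IsWeaklyFinitelyKoszul (γ : k →ₗc[k] C) : Prop :=
  ∀ n : ℕ, FiniteDimensional k (ExtTriv γ n)

end Main

end

end CoalgComod

/-! Cocommutativity makes the dual of `C` a commutative ring that acts on every comodule, and
comodule morphisms are linear over it. Conilpotency makes the augmentation ideal act locally
nilpotently, so a nonzero submodule always meets the socle (`exists_mem_socle`). The sequence Hom(k,
C) → Hom(k, C₊) → Ext¹(k, k) is exact with finite-dimensional ends, so the socle of C₊ is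
finite-dimensional. Its coordinate functions, extended to `C`, are finitely many elements of the
augmentation ideal whose common torsion in `C` lies in the line γ(k). A dual form of Hilbert's basis
argument (`isArtinian_of_torsionBy`), applied to one element at a time, then shows that `C` is
Artinian over its dual (`isArtinian_regular`). Finitely cogenerated comodules and their quotients
are therefore Artinian. The dual acts on a socle by scalars, so an Artinian comodule has
finite-dimensional socle (`finiteDimensional_socle`), and a comodule `Q` with finite-dimensional
socle embeds into the cofree comodule on that socle (`isFinCogenComod_of_socle`). This is the
co-Noetherian property; the right-hand version is the same statement because the flip fixes the
comultiplication. Since cofree comodules are injective, dimension shifting along L → C ⊗ V → coker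
gives finiteness of all Ext (`finiteDimensional_ext`). -/

/-! ### Artinian modules and locally nilpotent operators -/

section Artinian

variable {R M : Type*} [CommRing R] [AddCommGroup M] [Module R M]

/-- The submodule `xⁱ (N ∩ ker xⁱ⁺¹)` of the `x`-torsion of `M`. -/
def Submodule.torsionLayer (x : R) (N : Submodule R M) (i : ℕ) :
    Submodule R (Submodule.torsionBy R M x) :=
  ((N ⊓ Submodule.torsionBy R M (x ^ (i + 1))).map (LinearMap.lsmul R M (x ^ i))).comap
    (Submodule.torsionBy R M x).subtype

theorem Submodule.mem_torsionLayer {x : R} {N : Submodule R M} {i : ℕ}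
    {z : Submodule.torsionBy R M x} :
    z ∈ N.torsionLayer x i ↔ ∃ y ∈ N, x ^ (i + 1) • y = 0 ∧ x ^ i • y = z := by
  simp [Submodule.torsionLayer, and_assoc]

theorem Submodule.torsionLayer_mono (x : R) {N N' : Submodule R M} (h : N ≤ N') (i : ℕ) :
    N.torsionLayer x i ≤ N'.torsionLayer x i := by
  intro z hz
  rw [Submodule.mem_torsionLayer] at hz ⊢
  obtain ⟨y, hy, h1, h2⟩ := hz
  exact ⟨y, h hy, h1, h2⟩

theorem Submodule.torsionLayer_antitone (x : R) (N : Submodule R M) :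
    Antitone (N.torsionLayer x) := by
  refine antitone_nat_of_succ_le fun i z hz => ?_
  rw [Submodule.mem_torsionLayer] at hz ⊢
  obtain ⟨y, hy, h1, h2⟩ := hz
  refine ⟨x • y, N.smul_mem x hy, ?_, ?_⟩
  · rw [smul_smul, ← pow_succ, h1]
  · rw [smul_smul, ← pow_succ, h2]

/-- The layers play the role of the leading-coefficient ideals in Hilbert's basis theorem: matching
the top layer of `y` by an element `w` of `N` leaves `y - w`, which a smaller power of `x` kills. -/
theorem Submodule.le_of_torsionLayer_le {x : R} (hx : ∀ m : M, ∃ n : ℕ, x ^ n • m = 0)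
    {N N' : Submodule R M} (hle : N ≤ N')
    (h : ∀ i, N'.torsionLayer x i ≤ N.torsionLayer x i) : N' ≤ N := by
  have key : ∀ i : ℕ, ∀ y ∈ N', x ^ i • y = 0 → y ∈ N := by
    intro i
    induction i with
    | zero =>
      intro y _ h0
      rw [pow_zero, one_smul] at h0
      rw [h0]
      exact N.zero_mem
    | succ i ih =>
      intro y hy h0
      have hz : x ^ i • y ∈ Submodule.torsionBy R M x := by
        rw [Submodule.mem_torsionBy_iff, smul_smul, ← pow_succ', h0]
      obtain ⟨w, hw, _, hw2⟩ := Submodule.mem_torsionLayer.1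
        (h i (Submodule.mem_torsionLayer.2 ⟨y, hy, h0, rfl⟩ :
          (⟨x ^ i • y, hz⟩ : Submodule.torsionBy R M x) ∈ N'.torsionLayer x i))
      have := ih (y - w) (N'.sub_mem hy (hle hw)) (by
        rw [smul_sub, hw2, sub_self])
      simpa using N.add_mem this hw
  intro y hy
  obtain ⟨n, hn⟩ := hx y
  exact key n y hy hn

/-- A module on which `x` acts locally nilpotently is Artinian if its `x`-torsion is. -/
theorem isArtinian_of_torsionBy {x : R} (hx : ∀ m : M, ∃ n : ℕ, x ^ n • m = 0)
    [IsArtinian R (Submodule.torsionBy R M x)] : IsArtinian R M := by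
  refine monotone_stabilizes_iff_artinian.1 fun f => ?_
  have hf : ∀ {a b : ℕ}, a ≤ b → OrderDual.ofDual (f b) ≤ OrderDual.ofDual (f a) :=
    fun h => f.monotone h
  have hstab : ∀ i : ℕ, ∃ n, ∀ j, n ≤ j →
      (OrderDual.ofDual (f n)).torsionLayer x i = (OrderDual.ofDual (f j)).torsionLayer x i :=
    fun i => IsArtinian.monotone_stabilizes (R := R) (M := Submodule.torsionBy R M x)
      ⟨fun j => OrderDual.toDual ((OrderDual.ofDual (f j)).torsionLayer x i),
        fun a b hab => Submodule.torsionLayer_mono x (hf hab) i⟩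
  choose g hg using hstab
  -- The layers decrease in the layer index as well as along the chain, so the diagonal is a
  -- descending chain. Beyond `d` it controls all layers at once, and only the finitely many layers
  -- below `d` need their own bound `g i`.
  obtain ⟨d, hd⟩ := IsArtinian.monotone_stabilizes (R := R) (M := Submodule.torsionBy R M x)
    ⟨fun j => OrderDual.toDual ((OrderDual.ofDual (f j)).torsionLayer x j),
      fun a b hab => (Submodule.torsionLayer_antitone x _ hab).trans
        (Submodule.torsionLayer_mono x (hf hab) a)⟩
  have hd' : ∀ j, d ≤ j → (OrderDual.ofDual (f d)).torsionLayer x d =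
      (OrderDual.ofDual (f j)).torsionLayer x j := hd
  let n := d ⊔ (Finset.range d).sup g
  refine ⟨n, fun j hj => le_antisymm ?_ ?_⟩
  · exact f.monotone hj
  · change OrderDual.ofDual (f n) ≤ OrderDual.ofDual (f j)
    refine Submodule.le_of_torsionLayer_le hx (hf hj) fun i => ?_
    by_cases hi : i < d
    · have h1 : g i ≤ n := (Finset.le_sup (f := g) (Finset.mem_range.2 hi)).trans le_sup_right
      rw [← hg i n h1, ← hg i j (h1.trans hj)]
    · push Not at hi
      have hdn : d ≤ n := le_sup_left
      calc (OrderDual.ofDual (f n)).torsionLayer x i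
          ≤ (OrderDual.ofDual (f d)).torsionLayer x d :=
            (Submodule.torsionLayer_antitone x _ hi).trans
              (Submodule.torsionLayer_mono x (hf hdn) d)
        _ = (OrderDual.ofDual (f (i ⊔ j))).torsionLayer x (i ⊔ j) := hd' _ (hi.trans le_sup_left)
        _ ≤ (OrderDual.ofDual (f (i ⊔ j))).torsionLayer x i :=
            Submodule.torsionLayer_antitone x _ le_sup_left
        _ ≤ (OrderDual.ofDual (f j)).torsionLayer x i :=
            Submodule.torsionLayer_mono x (hf le_sup_right) i

end Artinian

/-- A module is Artinian if finitely many elements of the ring act on it locally nilpotently and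
their common torsion is Artinian. -/
theorem isArtinian_of_torsionBySet {R : Type*} [CommRing R] {s : Set R} (hs : s.Finite) :
    ∀ {M : Type u} [AddCommGroup M] [Module R M],
      (∀ x ∈ s, ∀ m : M, ∃ n : ℕ, x ^ n • m = 0) →
        IsArtinian R (Submodule.torsionBySet R M s) → IsArtinian R M := by
  induction s, hs using Set.Finite.induction_on with
  | empty =>
    intro M _ _ _ h
    have : IsArtinian R (⊤ : Submodule R M) := isArtinian_of_le (t := Submodule.torsionBySet R M ∅)
      fun m _ => by simp [Submodule.mem_torsionBySet_iff]
    exact isArtinian_of_surjective _ (Submodule.topEquiv (R := R) (M := M)).toLinearMap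
      Submodule.topEquiv.surjective
  | @insert x s _ _ ih =>
    intro M _ _ hnil h
    -- The induction hypothesis is applied to the `x`-torsion of `M`, whose `s`-torsion embeds into
    -- the torsion for `insert x s`.
    have hK : IsArtinian R (Submodule.torsionBy R M x) := by
      refine ih (fun y hy m => ?_) ?_
      · obtain ⟨n, hn⟩ := hnil y (Set.mem_insert_of_mem _ hy) m
        exact ⟨n, Subtype.ext hn⟩
      · let f : Submodule.torsionBySet R (Submodule.torsionBy R M x) s →ₗ[R]
            Submodule.torsionBySet R M (insert x s) :=
          ((Submodule.torsionBy R M x).subtype ∘ₗ Submodule.subtype _).codRestrict _ (by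
            rintro ⟨⟨m, hm⟩, hm'⟩
            rw [Submodule.mem_torsionBySet_iff] at hm' ⊢
            rintro ⟨y, rfl | hy⟩
            · exact hm
            · exact congrArg Subtype.val (hm' ⟨y, hy⟩))
        refine isArtinian_of_injective f fun a b hab => ?_
        exact Subtype.ext (Subtype.ext (Subtype.ext_iff.1 hab : _))
    exact isArtinian_of_torsionBy (hnil x (Set.mem_insert _ _))

/-! ### The dual algebra and its action on comodules -/

namespace CoalgComod

noncomputable section

variable {k C : Type u} [Field k] [AddCommGroup C] [Module k C] [Coalgebra k C]

/-- The dual of a coalgebra, with the convolution product. -/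
def DualAlg (k C : Type u) [Field k] [AddCommGroup C] [Module k C] : Type u :=
  WithConv (C →ₗ[k] k)

namespace DualAlg

/-- The element of the dual algebra given by a linear functional. -/
def of (a : C →ₗ[k] k) : DualAlg k C := WithConv.toConv a

/-- The linear functional given by an element of the dual algebra. -/
def lin (a : DualAlg k C) : C →ₗ[k] k := WithConv.ofConv a

instance [Coalgebra.IsCocomm k C] : CommRing (DualAlg k C) :=
  inferInstanceAs (CommRing (WithConv (C →ₗ[k] k)))

instance : SMul k (DualAlg k C) := inferInstanceAs (SMul k (WithConv (C →ₗ[k] k)))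

end DualAlg

/-- Contraction of the first tensor factor with a linear functional. -/
def contractLeft {M : Type u} [AddCommGroup M] [Module k M] (a : C →ₗ[k] k) :
    C ⊗[k] M →ₗ[k] M :=
  (TensorProduct.lid k M).toLinearMap ∘ₗ a.rTensor M

@[simp]
theorem contractLeft_tmul {M : Type u} [AddCommGroup M] [Module k M] (a : C →ₗ[k] k) (c : C)
    (m : M) : contractLeft a (c ⊗ₜ[k] m) = a c • m := by
  simp [contractLeft]

theorem contractLeft_lTensor {M N : Type u} [AddCommGroup M] [Module k M] [AddCommGroup N]
    [Module k N] (a : C →ₗ[k] k) (f : M →ₗ[k] N) (t : C ⊗[k] M) :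
    contractLeft a (f.lTensor C t) = f (contractLeft a t) := by
  have : contractLeft a ∘ₗ f.lTensor C = f ∘ₗ contractLeft a := by ext; simp
  exact LinearMap.congr_fun this t

/-- The counit recovers the value of a functional from its action on `C`; this turns annihilation in
the regular comodule into vanishing of values. -/
theorem counit_contractLeft_comul (a : C →ₗ[k] k) (c : C) :
    Coalgebra.counit (R := k) (contractLeft a (Coalgebra.comul (R := k) c)) = a c := by
  have h : Coalgebra.counit (R := k) (A := C) ∘ₗ contractLeft a =
      a ∘ₗ (TensorProduct.rid k C).toLinearMap ∘ₗ
        (Coalgebra.counit (R := k) (A := C)).lTensor C := by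
    ext x y; simp [mul_comm]
  refine (LinearMap.congr_fun h _).trans ?_
  simp

/-- An element of `C ⊗ M` annihilated by all contractions is zero. -/
theorem eq_zero_of_contractLeft {M : Type u} [AddCommGroup M] [Module k M] {t : C ⊗[k] M}
    (h : ∀ a : C →ₗ[k] k, contractLeft a t = 0) : t = 0 := by
  let b := Module.Free.chooseBasis k C
  have hb : (TensorProduct.equivFinsuppOfBasisLeft (M := C) (N := M) b) t = 0 := by
    ext i
    have : (Finsupp.lapply i : _ →ₗ[k] M) ∘ₗ
        (TensorProduct.equivFinsuppOfBasisLeft (M := C) (N := M) b).toLinearMap =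
        contractLeft (b.coord i) := by
      ext c m; simp
    exact (LinearMap.congr_fun this t).trans (h _)
  simpa using hb

namespace Comod

/-- The action of the dual algebra on a comodule. -/
def act (M : Comod k C) (a : C →ₗ[k] k) : M →ₗ[k] M := contractLeft a ∘ₗ M.coact

/-- This is coassociativity of the coaction, contracted with both functionals. The order is
reversed: a left comodule is naturally a right module over the convolution algebra. -/
theorem act_convMul [Coalgebra.IsCocomm k C] (M : Comod k C) (a b : DualAlg k C) (m : M) :
    M.act (a * b).lin m = M.act b.lin (M.act a.lin m) := by
  have h1 : contractLeft b.lin ∘ₗ contractLeft a.lin ∘ₗ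
      (TensorProduct.assoc k C C M).toLinearMap ∘ₗ
      (Coalgebra.comul (R := k) (A := C)).rTensor M = contractLeft (a * b).lin := by
    have h0 : contractLeft (M := M) b.lin ∘ₗ contractLeft a.lin ∘ₗ
        (TensorProduct.assoc k C C M).toLinearMap =
        contractLeft (LinearMap.mul' k k ∘ₗ TensorProduct.map a.lin b.lin) := by
      ext x y m
      simp [smul_smul]
    rw [← LinearMap.comp_assoc _ _ (contractLeft a.lin),
      ← LinearMap.comp_assoc _ _ (contractLeft b.lin), h0]
    rw [contractLeft, LinearMap.comp_assoc, ← LinearMap.rTensor_comp]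
    rfl
  have h2 := LinearMap.congr_fun M.coassoc m
  have h3 := LinearMap.congr_fun h1 (M.coact m)
  simp only [LinearMap.comp_apply] at h2 h3
  rw [act, LinearMap.comp_apply, ← h3, h2, contractLeft_lTensor]
  rfl

theorem act_counit (M : Comod k C) : M.act Coalgebra.counit = LinearMap.id := M.counit

theorem act_add (M : Comod k C) (a b : C →ₗ[k] k) : M.act (a + b) = M.act a + M.act b := by
  simp [act, contractLeft, LinearMap.rTensor_add, LinearMap.comp_add, LinearMap.add_comp]

theorem act_smul (M : Comod k C) (r : k) (a : C →ₗ[k] k) : M.act (r • a) = r • M.act a := by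
  simp [act, contractLeft, LinearMap.rTensor_smul, LinearMap.comp_smul, LinearMap.smul_comp]

theorem act_zero (M : Comod k C) : M.act 0 = 0 := by simp [act, contractLeft]

variable [Coalgebra.IsCocomm k C]

/-- A comodule over a cocommutative coalgebra is a module over the dual algebra. -/
instance (M : Comod k C) : Module (DualAlg k C) M where
  smul a m := M.act a.lin m
  one_smul m := LinearMap.congr_fun M.act_counit m
  mul_smul a b m := by
    rw [mul_comm a b]
    exact act_convMul M b a m
  smul_zero a := map_zero _
  smul_add a := map_add _
  add_smul a b m := LinearMap.congr_fun (act_add M a.lin b.lin) m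
  zero_smul m := LinearMap.congr_fun (act_zero M) m

theorem dual_smul_def (M : Comod k C) (a : DualAlg k C) (m : M) :
    a • m = contractLeft a.lin (M.coact m) := rfl

instance (M : Comod k C) : IsScalarTower k (DualAlg k C) M where
  smul_assoc r a m := LinearMap.congr_fun (act_smul M r a.lin) m

/-- Morphisms of comodules are linear over the dual algebra. -/
def Hom.dualLin {M N : Comod k C} (f : M ⟶ N) : M →ₗ[DualAlg k C] N where
  toFun := Hom.lin f
  map_add' := map_add _
  map_smul' a m := by
    have h := LinearMap.congr_fun (Hom.comm f) m
    simp only [LinearMap.comp_apply] at h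
    exact ((congrArg (contractLeft a.lin) h).trans (contractLeft_lTensor _ _ _)).symm

end Comod

variable (k C) in
/-- The coalgebra `C` as a left comodule over itself. -/
def regular : Comod k C where
  carrier := C
  coact := Coalgebra.comul
  coassoc := Coalgebra.coassoc
  counit := by
    rw [Coalgebra.rTensor_counit_comp_comul]
    ext x; simp

/-! ### The socle, the augmentation ideal and conilpotency -/

section Socle

open Comod

theorem comul_coaug (γ : k →ₗc[k] C) : Coalgebra.comul (R := k) (γ 1) = γ 1 ⊗ₜ[k] γ 1 :=
  (LinearMap.congr_fun γ.map_comp_comul (1 : k)).symm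

theorem counit_coaug (γ : k →ₗc[k] C) : Coalgebra.counit (R := k) (γ 1) = (1 : k) :=
  LinearMap.congr_fun γ.counit_comp (1 : k)

theorem coaug_apply (γ : k →ₗc[k] C) (t : k) : γ t = t • γ 1 := by
  rw [← map_smul, smul_eq_mul, mul_one]

/-- The coinvariants of a comodule with respect to the coaugmentation; when `C` is conilpotent,
this is the socle. -/
def socle (γ : k →ₗc[k] C) (M : Comod k C) : Submodule k M :=
  LinearMap.ker (M.coact - TensorProduct.mk k C M (γ 1))

theorem mem_socle {γ : k →ₗc[k] C} {M : Comod k C} {m : M} :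
    m ∈ socle γ M ↔ M.coact m = γ 1 ⊗ₜ[k] m := by
  rw [socle, LinearMap.mem_ker, LinearMap.sub_apply, sub_eq_zero]; rfl

variable [Coalgebra.IsCocomm k C]

/-- The augmentation ideal of the dual algebra. -/
def augIdeal (γ : k →ₗc[k] C) : Ideal (DualAlg k C) where
  carrier := {a | a.lin (γ 1) = 0}
  add_mem' {a b} ha hb := by
    change a.lin (γ 1) + b.lin (γ 1) = 0
    rw [ha, hb, add_zero]
  zero_mem' := rfl
  smul_mem' b a ha := by
    have ha' : a.lin (γ 1) = 0 := ha
    change LinearMap.mul' k k (TensorProduct.map b.lin a.lin (Coalgebra.comul (γ 1))) = 0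
    rw [comul_coaug]
    simp [ha']

theorem mem_augIdeal {γ : k →ₗc[k] C} {a : DualAlg k C} :
    a ∈ augIdeal γ ↔ a.lin (γ 1) = 0 := Iff.rfl

theorem augIdeal_pow_succ (γ : k →ₗc[k] C) (n : ℕ) :
    augIdeal γ ^ (n + 1) = augIdeal γ ^ n * augIdeal γ := pow_succ _ _

theorem smul_of_mem_socle {γ : k →ₗc[k] C} {M : Comod k C} {m : M} (hm : m ∈ socle γ M)
    (a : DualAlg k C) : a • m = a.lin (γ 1) • m := by
  rw [dual_smul_def, mem_socle.1 hm, contractLeft_tmul]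

/-- Contractions detect zero in C ⊗ M, and every functional `a` differs from `a (γ 1)` times the
counit, the unit of the dual algebra, by an element of the augmentation ideal. -/
theorem mem_socle_iff_smul {γ : k →ₗc[k] C} {M : Comod k C} {m : M} :
    m ∈ socle γ M ↔ ∀ a ∈ augIdeal γ, a • m = 0 := by
  refine ⟨fun hm a ha => ?_, fun h => ?_⟩
  · rw [smul_of_mem_socle hm, mem_augIdeal.1 ha, zero_smul]
  · rw [mem_socle, ← sub_eq_zero]
    refine eq_zero_of_contractLeft fun a => ?_
    have h1 := h (DualAlg.of (a - a (γ 1) • Coalgebra.counit)) (by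
      change a (γ 1) - a (γ 1) • Coalgebra.counit (R := k) (γ 1) = 0
      rw [counit_coaug, smul_eq_mul, mul_one, sub_self])
    have h2 : DualAlg.of (a - a (γ 1) • Coalgebra.counit (R := k) (A := C)) =
      DualAlg.of a - a (γ 1) • (1 : DualAlg k C) := rfl
    rw [h2, sub_smul, smul_assoc, one_smul, dual_smul_def] at h1
    rw [map_sub, contractLeft_tmul]
    exact h1

/-- Conilpotency in terms of the dual algebra. -/
def LocallyNilpotent (γ : k →ₗc[k] C) (M : Comod k C) : Prop :=
  ∀ m : M, ∃ n : ℕ, ∀ a ∈ augIdeal γ ^ n, a • m = 0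

/-- Contracting the last factor commutes with `g` on the first. The form fits the recursion of
`iterComul`, with `e` identifying D with its first tensor power. -/
theorem apply_rid_lTensor_eq_zero {D E F : Type u} [AddCommGroup D] [Module k D] [AddCommGroup E]
    [Module k E] [AddCommGroup F] [Module k F] (g : D →ₗ[k] E) (e : D ≃ₗ[k] F) (β : D →ₗ[k] k)
    {t : D ⊗[k] D} (ht : TensorProduct.map g e.toLinearMap t = 0) :
    g (TensorProduct.rid k D (β.lTensor D t)) = 0 := by
  have h : (TensorProduct.rid k E).toLinearMap ∘ₗ (β ∘ₗ e.symm.toLinearMap).lTensor E ∘ₗ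
      TensorProduct.map g e.toLinearMap =
      g ∘ₗ (TensorProduct.rid k D).toLinearMap ∘ₗ β.lTensor D := by
    ext x y; simp
  refine (LinearMap.congr_fun h t).symm.trans ?_
  rw [LinearMap.comp_apply, LinearMap.comp_apply, ht, map_zero, map_zero]

/-- `iterComul` splits off the right factor, whereas the action contracts the left one. The
resulting flip disappears on comultiplications by cocommutativity. -/
theorem rid_lTensor_liftQ {S : Submodule k C} {b : C →ₗ[k] k} (hb : S ≤ LinearMap.ker b)
    (t : C ⊗[k] C) :
    TensorProduct.rid k (C ⧸ S) ((S.liftQ b hb).lTensor (C ⧸ S)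
      (TensorProduct.map S.mkQ S.mkQ t)) =
      S.mkQ (contractLeft b (TensorProduct.comm k C C t)) := by
  have h : (TensorProduct.rid k (C ⧸ S)).toLinearMap ∘ₗ (S.liftQ b hb).lTensor (C ⧸ S) ∘ₗ
      TensorProduct.map S.mkQ S.mkQ =
      S.mkQ ∘ₗ contractLeft b ∘ₗ (TensorProduct.comm k C C).toLinearMap := by
    ext x y; simp
  exact LinearMap.congr_fun h t

/-- Contracting the last factor of μ⁽ⁿ⁺¹⁾(c) with `b` in the augmentation ideal gives μ⁽ⁿ⁾(b • c),
so each comultiplication accounts for one factor of the ideal. The exponent is `n + 1` because μ⁽⁰⁾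
is the identity: its vanishing puts `c` in γ(k), which the first power kills. -/
theorem smul_eq_zero_of_iterComul (γ : k →ₗc[k] C) (n : ℕ) :
    ∀ c : regular k C, iterComul (comulPlus γ) n
      ((LinearMap.range γ.toLinearMap).mkQ (c : C)) = 0 →
        ∀ a ∈ augIdeal γ ^ (n + 1), a • c = 0 := by
  induction n with
  | zero =>
    intro c hc a ha
    have h0 : (LinearMap.range γ.toLinearMap).mkQ (c : C) = 0 :=
      (LinearEquiv.map_eq_zero_iff _).1 hc
    obtain ⟨t, ht⟩ := (Submodule.Quotient.mk_eq_zero _).1 h0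
    replace ha : a ∈ augIdeal γ := by
      have h1 : augIdeal γ ^ (0 + 1) = augIdeal γ := pow_one _
      rwa [h1] at ha
    have hs : c ∈ socle γ (regular k C) := by
      have h1 : c = t • (γ 1 : C) := ht.symm.trans (coaug_apply γ t)
      rw [h1]
      exact Submodule.smul_mem (socle γ (regular k C)) t
        (mem_socle.2 (comul_coaug γ) : (γ 1 : C) ∈ socle γ (regular k C))
    exact mem_socle_iff_smul.1 hs a ha
  | succ n ih =>
    intro c hc a ha
    rw [augIdeal_pow_succ] at ha
    refine Submodule.mul_induction_on ha (fun a ha b hb => ?_) (fun a b ha hb => ?_)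
    · rw [mul_smul]
      refine ih _ ?_ a ha
      have hker : LinearMap.range γ.toLinearMap ≤ LinearMap.ker b.lin := by
        rintro _ ⟨t, rfl⟩
        change b.lin (γ t) = 0
        rw [coaug_apply, map_smul, mem_augIdeal.1 hb, smul_zero]
      let β : CPlus γ →ₗ[k] k := (LinearMap.range γ.toLinearMap).liftQ b.lin hker
      have h1 := apply_rid_lTensor_eq_zero _ _ β
        ((LinearEquiv.map_eq_zero_iff (TensorPower.mulEquiv (R := k) (M := CPlus γ))).1 hc)
      have h2 := (rid_lTensor_liftQ hker (Coalgebra.comul (R := k) (A := C) c)).trans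
        (congrArg (fun t => (LinearMap.range γ.toLinearMap).mkQ (contractLeft b.lin t))
          (Coalgebra.comm_comul k (A := C) c))
      exact (congrArg (iterComul (comulPlus γ) n) h2.symm).trans h1
    · rw [add_smul, ha, hb, add_zero]

variable {γ : k →ₗc[k] C}

theorem locallyNilpotent_regular (hγ : IsConilpotent γ) : LocallyNilpotent γ (regular k C) := by
  intro c
  obtain ⟨n, _, hn⟩ := hγ ((LinearMap.range γ.toLinearMap).mkQ (c : C))
  exact ⟨n + 1, smul_eq_zero_of_iterComul γ n c hn⟩

/-- The coaction of an element involves finitely many `c` in `C`; a power of the ideal that kills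
`c` under the action also vanishes on `c`, by applying the counit. -/
theorem locallyNilpotent_of_isConilpotent (hγ : IsConilpotent γ) (M : Comod k C) :
    LocallyNilpotent γ M := by
  have key : ∀ t : C ⊗[k] M, ∃ n : ℕ, ∀ a ∈ augIdeal γ ^ n, contractLeft a.lin t = 0 := by
    intro t
    induction t with
    | zero => exact ⟨0, fun a _ => map_zero _⟩
    | tmul c m =>
      obtain ⟨n, hn⟩ := locallyNilpotent_regular hγ c
      refine ⟨n, fun a ha => ?_⟩
      have h1 := counit_contractLeft_comul a.lin c
      have h3 : contractLeft a.lin (Coalgebra.comul (R := k) c) = 0 := hn a ha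
      rw [contractLeft_tmul, ← h1, h3, map_zero, zero_smul]
    | add s t hs ht =>
      obtain ⟨p, hp⟩ := hs
      obtain ⟨q, hq⟩ := ht
      refine ⟨p ⊔ q, fun a ha => ?_⟩
      rw [map_add, hp a (Ideal.pow_le_pow_right le_sup_left ha),
        hq a (Ideal.pow_le_pow_right le_sup_right ha), add_zero]
  exact fun m => key (M.coact m)

/-- Over a conilpotent coalgebra, every nonzero subobject meets the socle. -/
theorem exists_mem_socle (hγ : IsConilpotent γ) {M : Comod k C} {N : Submodule (DualAlg k C) M}
    (hN : N ≠ ⊥) : ∃ m ∈ N, m ≠ 0 ∧ m ∈ socle γ M := by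
  classical
  obtain ⟨m, hm, hm0⟩ := Submodule.exists_mem_ne_zero_of_ne_bot hN
  have hex := locallyNilpotent_of_isConilpotent hγ M m
  -- The least power of the ideal killing `m` is positive since `m ≠ 0`. One power lower, some
  -- multiple of `m` survives, and the ideal kills it.
  obtain ⟨n, hn⟩ : ∃ n, Nat.find hex = n + 1 := by
    refine Nat.exists_eq_succ_of_ne_zero fun h0 => hm0 ?_
    have := Nat.find_spec hex 1 (by
      have h1 : augIdeal γ ^ 0 = ⊤ := (pow_zero _).trans Ideal.one_eq_top
      rw [h0, h1]
      trivial)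
    rwa [one_smul] at this
  have h1 := Nat.find_min hex (m := n) (by lia)
  push Not at h1
  obtain ⟨a, ha, ham⟩ := h1
  refine ⟨a • m, N.smul_mem a hm, ham, mem_socle_iff_smul.2 fun b hb => ?_⟩
  rw [smul_smul]
  refine Nat.find_spec hex _ ?_
  rw [hn, augIdeal_pow_succ, mul_comm b a]
  exact Ideal.mul_mem_mul ha hb

end Socle

/-! ### Cofree comodules: universal property and injectivity -/

section Cofree

open Comod

variable {V : Type u} [AddCommGroup V] [Module k V]

theorem contractLeft_counit_coact (M : Comod k C) :
    contractLeft Coalgebra.counit ∘ₗ M.coact = LinearMap.id := M.counit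

variable (C V) in
/-- The linear map `C ⊗ V → V` induced by the counit. -/
def cofreeCounit : cofree k C V →ₗ[k] V := contractLeft (M := V) (Coalgebra.counit (R := k) (A := C))

/-- The comodule morphism into a cofree comodule given by a linear map. -/
def cofreeLift (M : Comod k C) (g : M →ₗ[k] V) : M ⟶ cofree k C V where
  lin := g.lTensor C ∘ₗ M.coact
  comm := by
    have e1 : (Coalgebra.comul (R := k) (A := C)).rTensor V ∘ₗ g.lTensor C =
        g.lTensor (C ⊗[k] C) ∘ₗ (Coalgebra.comul (R := k) (A := C)).rTensor M := by
      rw [LinearMap.rTensor_comp_lTensor, LinearMap.lTensor_comp_rTensor]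
    have e2 : (TensorProduct.assoc k C C V).toLinearMap ∘ₗ g.lTensor (C ⊗[k] C) =
        (g.lTensor C).lTensor C ∘ₗ (TensorProduct.assoc k C C M).toLinearMap := by
      ext x y z; simp
    change ((TensorProduct.assoc k C C V).toLinearMap ∘ₗ
      (Coalgebra.comul (R := k) (A := C)).rTensor V) ∘ₗ g.lTensor C ∘ₗ M.coact = _
    rw [LinearMap.comp_assoc, ← LinearMap.comp_assoc M.coact, e1, LinearMap.comp_assoc,
      ← LinearMap.comp_assoc _ _ (TensorProduct.assoc k C C V).toLinearMap, e2,
      LinearMap.comp_assoc, M.coassoc, ← LinearMap.comp_assoc, ← LinearMap.lTensor_comp]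
    rfl

theorem cofreeLift_lin (M : Comod k C) (g : M →ₗ[k] V) :
    Hom.lin (cofreeLift M g) = g.lTensor C ∘ₗ M.coact := rfl

theorem cofreeCounit_comp_cofreeLift (M : Comod k C) (g : M →ₗ[k] V) :
    cofreeCounit C V ∘ₗ Hom.lin (cofreeLift M g) = g := by
  ext m
  change contractLeft Coalgebra.counit (g.lTensor C (M.coact m)) = g m
  rw [contractLeft_lTensor]
  exact congrArg g (LinearMap.congr_fun (contractLeft_counit_coact M) m)

/-- With `cofreeCounit_comp_cofreeLift`, this yields the bijection between morphisms M → C ⊗ V and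
linear maps M → V. -/
theorem lTensor_cofreeCounit_comp_coact :
    (cofreeCounit C V).lTensor C ∘ₗ (cofree k C V).coact = LinearMap.id := by
  have h2 : (contractLeft (M := V) (Coalgebra.counit (R := k) (A := C))).lTensor C ∘ₗ
      (TensorProduct.assoc k C C V).toLinearMap =
      ((TensorProduct.rid k C).toLinearMap ∘ₗ
        (Coalgebra.counit (R := k) (A := C)).lTensor C).rTensor V := by
    ext x y v; simp [TensorProduct.smul_tmul]
  have h3 : ((TensorProduct.rid k C).toLinearMap ∘ₗ
      (Coalgebra.counit (R := k) (A := C)).lTensor C) ∘ₗ Coalgebra.comul (R := k) (A := C) =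
        LinearMap.id := by
    rw [LinearMap.comp_assoc, Coalgebra.lTensor_counit_comp_comul]
    ext x; simp
  change (contractLeft (M := V) (Coalgebra.counit (R := k) (A := C))).lTensor C ∘ₗ
    (TensorProduct.assoc k C C V).toLinearMap ∘ₗ
      (Coalgebra.comul (R := k) (A := C)).rTensor V = (LinearMap.id : C ⊗[k] V →ₗ[k] C ⊗[k] V)
  rw [← LinearMap.comp_assoc, h2, ← LinearMap.rTensor_comp, h3, LinearMap.rTensor_id]

theorem cofreeLift_cofreeCounit {M : Comod k C} (f : M ⟶ cofree k C V) :
    cofreeLift M (cofreeCounit C V ∘ₗ Hom.lin f) = f := by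
  apply hom_ext
  rw [cofreeLift_lin]
  refine Eq.trans ?_ (congrArg (· ∘ₗ Hom.lin f) (lTensor_cofreeCounit_comp_coact (V := V)))
  change _ = ((cofreeCounit C V).lTensor C ∘ₗ (cofree k C V).coact) ∘ₗ Hom.lin f
  rw [LinearMap.comp_assoc, Hom.comm f, LinearMap.lTensor_comp, LinearMap.comp_assoc]

theorem cofree_hom_ext {M : Comod k C} {f g : M ⟶ cofree k C V}
    (h : cofreeCounit C V ∘ₗ Hom.lin f = cofreeCounit C V ∘ₗ Hom.lin g) : f = g := by
  rw [← cofreeLift_cofreeCounit f, h, cofreeLift_cofreeCounit]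

/-- Cofree comodules are injective. -/
instance injective_cofree : Injective (cofree k C V) where
  factors {X Y} g f _ := by
    -- By the universal property it suffices to extend a linear map to V, so a linear retraction is
    -- enough.
    obtain ⟨r, hr⟩ := (Hom.lin f).exists_leftInverse_of_injective
      (LinearMap.ker_eq_bot.2 (injective_of_mono f))
    refine ⟨cofreeLift Y (cofreeCounit C V ∘ₗ Hom.lin g ∘ₗ r), cofree_hom_ext ?_⟩
    rw [comp_lin, ← LinearMap.comp_assoc, cofreeCounit_comp_cofreeLift, LinearMap.comp_assoc,
      LinearMap.comp_assoc, hr, LinearMap.comp_id]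

/-- The morphism `C ⊗ V → C` given by a linear functional on `V`. -/
def cofreeToRegular (φ : V →ₗ[k] k) : cofree k C V ⟶ regular k C where
  lin := (TensorProduct.rid k C).toLinearMap ∘ₗ φ.lTensor C
  comm := by
    have h1 : ((TensorProduct.rid k C).toLinearMap ∘ₗ φ.lTensor C).lTensor C ∘ₗ
        (TensorProduct.assoc k C C V).toLinearMap =
        (TensorProduct.rid k (C ⊗[k] C)).toLinearMap ∘ₗ φ.lTensor (C ⊗[k] C) := by
      ext x y v; simp
    have h2 : Coalgebra.comul (R := k) (A := C) ∘ₗ (TensorProduct.rid k C).toLinearMap ∘ₗ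
        φ.lTensor C = (TensorProduct.rid k (C ⊗[k] C)).toLinearMap ∘ₗ φ.lTensor (C ⊗[k] C) ∘ₗ
          (Coalgebra.comul (R := k) (A := C)).rTensor V := by
      ext x v; simp
    change Coalgebra.comul (R := k) (A := C) ∘ₗ (TensorProduct.rid k C).toLinearMap ∘ₗ
      φ.lTensor C = ((TensorProduct.rid k C).toLinearMap ∘ₗ φ.lTensor C).lTensor C ∘ₗ
        (TensorProduct.assoc k C C V).toLinearMap ∘ₗ
          (Coalgebra.comul (R := k) (A := C)).rTensor V
    rw [← LinearMap.comp_assoc _ (TensorProduct.assoc k C C V).toLinearMap, h1, h2,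
      LinearMap.comp_assoc]

/-- Coordinates on V embed C ⊗ V into a product of copies of `C`; for finite-dimensional V this
carries the Artinian property from `C` to C ⊗ V. -/
theorem eq_zero_of_cofreeToRegular {ι : Type*} (b : Module.Basis ι k V) {t : cofree k C V}
    (h : ∀ i, Hom.lin (cofreeToRegular (C := C) (b.coord i)) t = 0) : t = 0 := by
  classical
  have hb : (TensorProduct.equivFinsuppOfBasisRight (M := C) (N := V) b) t = 0 := by
    ext i
    have : (Finsupp.lapply i : _ →ₗ[k] C) ∘ₗ
        (TensorProduct.equivFinsuppOfBasisRight (M := C) (N := V) b).toLinearMap =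
        (TensorProduct.rid k C).toLinearMap ∘ₗ (b.coord i).lTensor C := by
      ext c m; simp
    exact (LinearMap.congr_fun this t).trans (h i)
  exact (LinearEquiv.map_eq_zero_iff _).1 hb

end Cofree

/-! ### The coaugmentation as a comodule morphism -/

section Coaug

open Comod

variable {γ : k →ₗc[k] C}

/-- The coaugmentation as a morphism of comodules `k → C`. -/
def coaugHom (γ : k →ₗc[k] C) : triv γ ⟶ regular k C where
  lin := γ.toLinearMap
  comm := by
    apply LinearMap.ext_ring
    change Coalgebra.comul (R := k) (γ 1) = γ.toLinearMap.lTensor C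
      (γ.toLinearMap.rTensor k ((TensorProduct.lid k k).symm 1))
    rw [comul_coaug]
    simp

theorem coaugHom_injective (γ : k →ₗc[k] C) : Function.Injective (Hom.lin (coaugHom γ)) := by
  have h : ∀ t : k, Coalgebra.counit (R := k) (γ t) = t := fun t => by
    rw [coaug_apply γ t, map_smul, counit_coaug, smul_eq_mul, mul_one]
  exact Function.LeftInverse.injective h

theorem isFinCogenComod_cofree (V : Type u) [AddCommGroup V] [Module k V]
    [FiniteDimensional k V] : IsFinCogenComod (cofree k C V) :=
  ⟨V, inferInstance, inferInstance, inferInstance, 𝟙 _, Function.injective_id⟩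

end Coaug

/-! ### The Artinian property and finite cogeneration -/

section Artinian

open Comod

variable [Coalgebra.IsCocomm k C] {γ : k →ₗc[k] C}

theorem isArtinian_cofree [IsArtinian (DualAlg k C) (regular k C)] (V : Type u) [AddCommGroup V]
    [Module k V] [FiniteDimensional k V] : IsArtinian (DualAlg k C) (cofree k C V) := by
  let b := Module.finBasis k V
  let F : cofree k C V →ₗ[DualAlg k C] (Fin (Module.finrank k V) → regular k C) :=
    LinearMap.pi fun i => Hom.dualLin (cofreeToRegular (b.coord i))
  refine isArtinian_of_injective F ((injective_iff_map_eq_zero F).2 fun t ht => ?_)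
  exact eq_zero_of_cofreeToRegular b fun i => congrFun ht i

/-- The dual algebra acts on the socle through evaluation at `γ 1`, so every `k`-subspace of the
socle is a submodule of `Q` and the descending chain condition passes to subspaces. -/
theorem finiteDimensional_socle (Q : Comod k C) [IsArtinian (DualAlg k C) Q] :
    FiniteDimensional k (socle γ Q) := by
  let F : Submodule k (socle γ Q) → Submodule (DualAlg k C) Q := fun W =>
    { carrier := {q | ∃ w ∈ W, (w : Q) = q}
      add_mem' := by
        rintro _ _ ⟨v, hv, rfl⟩ ⟨w, hw, rfl⟩
        exact ⟨v + w, W.add_mem hv hw, rfl⟩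
      zero_mem' := ⟨0, W.zero_mem, rfl⟩
      smul_mem' := by
        rintro a _ ⟨w, hw, rfl⟩
        exact ⟨a.lin (γ 1) • w, W.smul_mem _ hw, (smul_of_mem_socle w.2 a).symm⟩ }
  have hF : ∀ {W W' : Submodule k (socle γ Q)}, F W ≤ F W' ↔ W ≤ W' := by
    intro W W'
    refine ⟨fun h w hw => ?_, fun h => ?_⟩
    · obtain ⟨w', hw', he⟩ := h (show (w : Q) ∈ F W from ⟨w, hw, rfl⟩)
      rwa [← Subtype.ext he]
    · rintro _ ⟨w, hw, rfl⟩
      exact ⟨w, h hw, rfl⟩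
  have : IsArtinian k (socle γ Q) := (OrderEmbedding.ofMapLEIff F fun _ _ => hF).wellFoundedLT
  exact (IsSemisimpleModule.finite_tfae.out 0 2).2 this

/-- Over a conilpotent coalgebra, a comodule with a finite-dimensional socle is finitely
cogenerated. -/
theorem isFinCogenComod_of_socle (hγ : IsConilpotent γ) {Q : Comod k C}
    [FiniteDimensional k (socle γ Q)] : IsFinCogenComod Q := by
  -- A linear projection onto the socle induces a morphism into the cofree comodule. Its kernel
  -- contains no nonzero socle element, because the counit recovers `π`; hence the kernel is zero.
  obtain ⟨π, hπ⟩ := (socle γ Q).subtype.exists_leftInverse_of_injective (Submodule.ker_subtype _)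
  refine ⟨socle γ Q, inferInstance, inferInstance, inferInstance, cofreeLift Q π, ?_⟩
  by_contra hinj
  have hker : LinearMap.ker (Hom.dualLin (cofreeLift Q π)) ≠ ⊥ :=
    fun h => hinj (LinearMap.ker_eq_bot.1 h : Function.Injective (Hom.dualLin _))
  obtain ⟨m, hm, hm0, hs⟩ := exists_mem_socle hγ hker
  have h1 : cofreeCounit C _ (Hom.lin (cofreeLift Q π) m) = π m :=
    LinearMap.congr_fun (cofreeCounit_comp_cofreeLift Q π) m
  have h2 : π m = ⟨m, hs⟩ := LinearMap.congr_fun hπ ⟨m, hs⟩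
  have h3 : Hom.lin (cofreeLift Q π) m = 0 := hm
  rw [h2, h3] at h1
  exact hm0 (congrArg Subtype.val ((map_zero _).symm.trans h1)).symm

theorem isLeftCoNoetherian_of_isArtinian (hγ : IsConilpotent γ)
    [IsArtinian (DualAlg k C) (regular k C)] : IsLeftCoNoetherian k C := by
  rintro L Q p hp ⟨V, _, _, _, f, hf⟩
  have := isArtinian_cofree (k := k) (C := C) V
  have : IsArtinian (DualAlg k C) L := isArtinian_of_injective (Hom.dualLin f) hf
  have : IsArtinian (DualAlg k C) Q := isArtinian_of_surjective _ (Hom.dualLin p) hp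
  have := finiteDimensional_socle (γ := γ) Q
  exact isFinCogenComod_of_socle hγ

/-- The regular comodule is Artinian over the dual algebra if `C₊` has a finite-dimensional
socle. -/
theorem isArtinian_regular (hγ : IsConilpotent γ)
    [FiniteDimensional k (socle γ (coker (coaugHom γ)))] :
    IsArtinian (DualAlg k C) (regular k C) := by
  set U := socle γ (coker (coaugHom γ)) with hU
  obtain ⟨π, hπ⟩ := U.subtype.exists_leftInverse_of_injective (Submodule.ker_subtype _)
  let b := Module.finBasis k U
  -- The coordinate functions of the socle of C₊, extended to C₊ along `π` and pulled back to `C`;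
  -- they vanish on γ(k).
  let x : Fin (Module.finrank k U) → DualAlg k C := fun i =>
    DualAlg.of (b.coord i ∘ₗ π ∘ₗ Hom.lin (cokerπ (coaugHom γ)))
  have hx : ∀ i, x i ∈ augIdeal γ := by
    intro i
    have h1 : Hom.lin (cokerπ (coaugHom γ)) (γ 1 : C) = 0 :=
      LinearMap.congr_fun (congrArg (fun f => Hom.lin f) (comp_cokerπ (coaugHom γ))) (1 : k)
    change b.coord i (π (Hom.lin (cokerπ (coaugHom γ)) (γ 1 : C))) = 0
    rw [h1, map_zero, map_zero]
  refine isArtinian_of_torsionBySet (Set.finite_range x) ?_ ?_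
  · rintro _ ⟨i, rfl⟩ c
    obtain ⟨n, hn⟩ := locallyNilpotent_regular hγ c
    exact ⟨n, hn _ (Ideal.pow_mem_pow (hx i) n)⟩
  set K := Submodule.torsionBySet (DualAlg k C) (regular k C) (Set.range x) with hK
  -- Otherwise the image contains a nonzero socle element of C₊, the class of some `c` in `K`.
  -- Applying the counit to `x i • c = 0` shows that all its coordinates vanish.
  have hbot : K.map (Hom.dualLin (cokerπ (coaugHom γ))) = ⊥ := by
    by_contra hne
    obtain ⟨_, ⟨c, hc, rfl⟩, hc0, hs⟩ := exists_mem_socle hγ hne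
    have h1 : ∀ i, b.coord i (π (Hom.lin (cokerπ (coaugHom γ)) c)) = 0 := by
      intro i
      have h2 : x i • c = 0 := (Submodule.mem_torsionBySet_iff _ _).1 hc ⟨x i, i, rfl⟩
      have h3 : Coalgebra.counit (R := k) (A := C)
          (contractLeft (x i).lin (Coalgebra.comul (R := k) (A := C) c)) = 0 :=
        (congrArg (Coalgebra.counit (R := k) (A := C)) h2).trans (map_zero _)
      exact (counit_contractLeft_comul (x i).lin c).symm.trans h3
    have h6 : π (Hom.lin (cokerπ (coaugHom γ)) c) = ⟨_, hs⟩ := LinearMap.congr_fun hπ ⟨_, hs⟩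
    have h7 : π (Hom.lin (cokerπ (coaugHom γ)) c) = 0 := b.forall_coord_eq_zero_iff.1 h1
    exact hc0 (congrArg Subtype.val (h6.symm.trans h7))
  have hrange : ∀ c ∈ K, ∃ t : k, γ t = (c : C) := by
    intro c hc
    have h1 : Hom.lin (cokerπ (coaugHom γ)) c = 0 := by
      have : Hom.dualLin (cokerπ (coaugHom γ)) c ∈ K.map (Hom.dualLin (cokerπ (coaugHom γ))) :=
        ⟨c, hc, rfl⟩
      rwa [hbot, Submodule.mem_bot] at this
    have h2 := (ker_cokerπ (coaugHom γ)).le h1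
    exact h2
  -- `K` lies in γ(k), where the counit is injective.
  have : FiniteDimensional k K := by
    let F : K →ₗ[k] k :=
      { toFun := fun c => Coalgebra.counit (R := k) (A := C) (c : regular k C)
        map_add' := fun c d => map_add (Coalgebra.counit (R := k) (A := C)) _ _
        map_smul' := fun r c => map_smul (Coalgebra.counit (R := k) (A := C)) _ _ }
    refine Module.Finite.of_injective F ((injective_iff_map_eq_zero F).2 ?_)
    rintro ⟨c, hc⟩ h0
    obtain ⟨t, ht⟩ := hrange c hc
    have h1 : Coalgebra.counit (R := k) (A := C) c = 0 := h0
    rw [← ht, coaug_apply, map_smul, counit_coaug, smul_eq_mul, mul_one] at h1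
    apply Subtype.ext
    change c = 0
    rw [← ht, h1]
    exact map_zero γ
  exact isArtinian_of_tower k inferInstance

end Artinian

/-! ### Finiteness of Ext -/

section Ext

open Comod Abelian

variable {γ : k →ₗc[k] C}

theorem exact_cokerπ {M N : Comod k C} (f : M ⟶ N) (hf : Function.Injective (Hom.lin f)) :
    (ShortComplex.mk f (cokerπ f) (comp_cokerπ f)).ShortExact :=
  haveI := mono_of_injective f hf
  haveI := epi_of_surjective (cokerπ f) (cokerπ_surjective f)
  { exact := ShortComplex.exact_of_g_is_cokernel _
      (isColimitOfExact f (cokerπ f) (cokerπ_surjective f) (comp_cokerπ f) (ker_cokerπ f).le) }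

/-- Hom(k, L) embeds into Hom(k, C ⊗ V), and by the universal property of cofree comodules the
latter embeds into the linear maps k → V. -/
theorem finiteDimensional_hom_triv {L : Comod k C} (hL : IsFinCogenComod L) :
    FiniteDimensional k (triv γ ⟶ L) := by
  obtain ⟨V, _, _, _, f, hf⟩ := hL
  have : FiniteDimensional k (triv γ) := inferInstanceAs (FiniteDimensional k k)
  let F : (triv γ ⟶ L) →ₗ[k] (triv γ →ₗ[k] V) :=
    { toFun := fun g => cofreeCounit C V ∘ₗ Hom.lin (g ≫ f)
      map_add' := fun g h => by
        rw [Preadditive.add_comp, add_lin, LinearMap.comp_add]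
      map_smul' := fun r g => by
        rw [Linear.smul_comp, smul_lin, LinearMap.comp_smul]; rfl }
  refine Module.Finite.of_injective F fun g h hgh => ?_
  have := mono_of_injective f hf
  rw [← cancel_mono f]
  exact cofree_hom_ext hgh

/-- A socle element `m` defines the morphism t ↦ t • m from the trivial comodule, and its value at 1
recovers `m`. -/
theorem finiteDimensional_socle_of_hom (Q : Comod k C) [FiniteDimensional k (triv γ ⟶ Q)] :
    FiniteDimensional k (socle γ Q) := by
  let F : socle γ Q →ₗ[k] (triv γ ⟶ Q) :=
    { toFun := fun m =>
        { lin := LinearMap.toSpanSingleton k Q m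
          comm := by
            apply LinearMap.ext_ring
            change Q.coact (LinearMap.toSpanSingleton k Q m 1) =
              (LinearMap.toSpanSingleton k Q m).lTensor C
                (γ.toLinearMap.rTensor k ((TensorProduct.lid k k).symm 1))
            rw [LinearMap.toSpanSingleton_apply, one_smul, mem_socle.1 m.2]
            simp }
      map_add' := fun m n => hom_ext (LinearMap.toSpanSingleton_add _ _)
      map_smul' := fun r m => hom_ext (LinearMap.toSpanSingleton_smul _ _) }
  refine Module.Finite.of_injective F fun m n hmn => ?_
  have h := LinearMap.congr_fun (congrArg (fun f => Hom.lin f) hmn) (1 : k)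
  change (1 : k) • (m : Q) = (1 : k) • (n : Q) at h
  rw [one_smul, one_smul] at h
  exact Subtype.ext h

theorem isFinCogenComod_regular : IsFinCogenComod (regular k C) := by
  refine ⟨k, inferInstance, inferInstance, inferInstance,
    cofreeLift (regular k C) (Coalgebra.counit (R := k) (A := C)), fun (c d : C) h => ?_⟩
  change (Coalgebra.counit (R := k) (A := C)).lTensor C (Coalgebra.comul (R := k) (A := C) c) =
    (Coalgebra.counit (R := k) (A := C)).lTensor C (Coalgebra.comul (R := k) (A := C) d) at h
  rw [Coalgebra.lTensor_counit_comul, Coalgebra.lTensor_counit_comul] at h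
  have h2 : c = d := by simpa using congrArg (TensorProduct.rid k C) h
  exact h2

theorem isFinCogenComod_triv : IsFinCogenComod (triv γ) := by
  obtain ⟨V, i1, i2, i3, f, hf⟩ := isFinCogenComod_regular (k := k) (C := C)
  exact ⟨V, i1, i2, i3, coaugHom γ ≫ f, hf.comp (coaugHom_injective γ)⟩

theorem finiteDimensional_ext_zero {L : Comod k C} (hL : IsFinCogenComod L) :
    FiniteDimensional k (Ext (triv γ) L 0) :=
  have := finiteDimensional_hom_triv (γ := γ) hL
  Module.Finite.equiv (Ext.linearEquiv₀ (R := k) (X := triv γ) (Y := L)).symm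

/-- For a finitely cogenerated conilpotent coalgebra, `C₊` has a finite-dimensional socle. -/
theorem finiteDimensional_socle_coker (h : IsFinCogenCoalgebra γ) :
    FiniteDimensional k (socle γ (coker (coaugHom γ))) := by
  have hS := exact_cokerπ (coaugHom γ) (coaugHom_injective γ)
  have h0 := finiteDimensional_ext_zero (γ := γ) (isFinCogenComod_regular (k := k) (C := C))
  have h1 : FiniteDimensional k (Ext (triv γ) (triv γ) 1) := h
  let F : Ext (triv γ) (regular k C) 0 →ₗ[k] Ext (triv γ) (coker (coaugHom γ)) 0 :=
    (Ext.bilinearCompOfLinear k (triv γ) (regular k C) (coker (coaugHom γ)) 0 0 0 rfl).flip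
      (Ext.mk₀ (cokerπ (coaugHom γ)))
  let G : Ext (triv γ) (coker (coaugHom γ)) 0 →ₗ[k] Ext (triv γ) (triv γ) 1 :=
    (Ext.bilinearCompOfLinear k (triv γ) (coker (coaugHom γ)) (triv γ) 0 1 1 rfl).flip
      hS.extClass
  have hFG : LinearMap.ker G ≤ LinearMap.range F := fun x hx =>
    -- Exactness at Hom(k, C₊): the kernel of the connecting map comes from Hom(k, C), and its
    -- target is Ext¹(k, k).
    Ext.covariant_sequence_exact₃ (triv γ) hS x rfl hx
  have h2 : Module.Finite k (LinearMap.ker G) :=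
    Module.Finite.of_injective (Submodule.inclusion hFG) (Submodule.inclusion_injective hFG)
  have h3 : IsNoetherian k (Ext (triv γ) (coker (coaugHom γ)) 0) :=
    isNoetherian_of_range_eq_ker (LinearMap.ker G).subtype G (Submodule.range_subtype _)
  have : FiniteDimensional k (triv γ ⟶ coker (coaugHom γ)) :=
    Module.Finite.equiv (Ext.linearEquiv₀ (R := k) (X := triv γ) (Y := coker (coaugHom γ)))
  exact finiteDimensional_socle_of_hom _

/-- Dimension shifting: the cokernel of L → C ⊗ V is again finitely cogenerated by co-Noetherianity,
so the induction must range over all such comodules. -/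
theorem finiteDimensional_ext (hC : IsLeftCoNoetherian k C) (n : ℕ) :
    ∀ {L : Comod k C}, IsFinCogenComod L → FiniteDimensional k (Ext (triv γ) L n) := by
  induction n with
  | zero => exact fun hL => finiteDimensional_ext_zero hL
  | succ n ih =>
    rintro L ⟨V, _, _, _, f, hf⟩
    have hS := exact_cokerπ f hf
    have := ih (hC _ _ (cokerπ f) (cokerπ_surjective f) (isFinCogenComod_cofree V))
    let G : Ext (triv γ) (coker f) n →ₗ[k] Ext (triv γ) L (n + 1) :=
      (Ext.bilinearCompOfLinear k (triv γ) (coker f) L n 1 (n + 1) rfl).flip hS.extClass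
    refine Module.Finite.of_surjective G fun x => ?_
    -- Positive Ext into the injective comodule C ⊗ V vanishes, so the connecting map is onto.
    exact Ext.covariant_sequence_exact₁ (triv γ) hS x (Ext.eq_zero_of_injective _) rfl

end Ext

/-! ### Left and right comodules in the cocommutative case -/

section Opposite

variable [Coalgebra.IsCocomm k C]

theorem isRightCoNoetherian_iff : IsRightCoNoetherian k C ↔ IsLeftCoNoetherian k C := by
  have hext : ∀ s₁ s₂ : CoalgebraStruct k C, s₁.comul = s₂.comul → s₁.counit = s₂.counit →
      s₁ = s₂ := by
    rintro ⟨⟩ ⟨⟩ rfl rfl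
    rfl
  -- `Cop C` is definitionally `C`, so both coalgebra structures live on one space; cocommutativity
  -- identifies their comultiplications and the counits agree by definition.
  have key : ∀ i₁ i₂ : Coalgebra k C, i₁.comul = i₂.comul → i₁.counit = i₂.counit →
      (@IsLeftCoNoetherian k C _ _ _ i₁ ↔ @IsLeftCoNoetherian k C _ _ _ i₂) := by
    rintro ⟨⟩ ⟨⟩ h1 h2
    obtain rfl := hext _ _ h1 h2
    rfl
  exact key (inferInstanceAs (Coalgebra k (Cop C))) inferInstance (Coalgebra.comm_comp_comul k C)
    rfl

end Opposite

end

end CoalgComod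

theorem mainTheorem10 {k C : Type u} [Field k] [AddCommGroup C] [Module k C] [Coalgebra k C]
    [Coalgebra.IsCocomm k C] (γ : k →ₗc[k] C)
    (hconil : CoalgComod.IsConilpotent γ) (hcogen : CoalgComod.IsFinCogenCoalgebra γ) :
    (CoalgComod.IsLeftCoNoetherian k C ∧ CoalgComod.IsRightCoNoetherian k C) ∧
      CoalgComod.IsWeaklyFinitelyKoszul γ := by
  have := CoalgComod.finiteDimensional_socle_coker hcogen
  have := CoalgComod.isArtinian_regular hconil
  have hC := CoalgComod.isLeftCoNoetherian_of_isArtinian hconil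
  exact ⟨⟨hC, CoalgComod.isRightCoNoetherian_iff.2 hC⟩,
    fun n => CoalgComod.finiteDimensional_ext hC n CoalgComod.isFinCogenComod_triv⟩
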